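/- Let $\Omega=(a,b)\times(c,d)$, $1<\alpha<2$, $\kappa_1,\kappa_2,\gamma>0$, $v_1,v_2\in\mathbb R$, $g\in L^1(\Omega)$, $u_d\in L^2(\Omega)$, and $\mathscr K=\{q\in L^2(\Omega): v_1\le q\le v_2 \text{ a.e. in }\Omega\}$. For non-integer $\mu>0$ and $n=\lceil\mu\rceil$ let $${}^L_aD_x^\mu f(x)=\frac{1}{\Gamma(n-\mu)}\frac{d^n}{dx^n}\int_a^x (x-s)^{n-1-\mu}f(s)\,ds,\qquad {}^R_xD_b^\mu f(x)=\frac{(-1)^n}{\Gamma(n-\mu)}\frac{d^n}{dx^n}\int_x^b (s-x)^{n-1-\mu}f(s)\,ds,$$ let $\frac{\partial^\alpha u}{\partial|x|^\alpha}=-\frac{1}{2\cos(\pi\alpha/2)}\big({}^L_aD_x^\alpha u+{}^R_xD_b^\alpha u\big)$, and similarly in $y$ on $(c,d)$. Let $H_0^{\mu}(\Omega)$ be the closure of $C_0^\infty(\Omega)$ in the norm $\big(\|u\|_{L^2(\Omega)}^2+\||\omega|^{\mu}\mathcal F[\tilde u]\|_{L^2(\mathbb R^2)}^2\big)^{1/2}$,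 where $\tilde u$ is the extension of $u$ by zero. Fix a sign $\sigma\in\{1,-1\}$. For a right-hand side $f$, a solution of $$\sigma\Big(\kappa_1\frac{\partial^\alpha u}{\partial|x|^\alpha}+\kappa_2\frac{\partial^\alpha u}{\partial|y|^\alpha}\Big)=f\ \text{ in }\Omega,\qquad u=0\ \text{ on }\partial\Omega \qquad (\mathrm S_f)$$ is a function $u\in H_0^{\alpha/2}(\Omega)$ with $\int_\Omega u\,\sigma\big(\kappa_1\frac{\partial^\alpha \varphi}{\partial|x|^\alpha}+\kappa_2\frac{\partial^\alpha \varphi}{\partial|y|^\alpha}\big)=\int_\Omega f\varphi$ for all $\varphi\in C_0^\infty(\Omega)$. Let $(q,u)$ minimize $J(u,q)=\frac12\|u-u_d\|_{L^2(\Omega)}^2+\frac\gamma2\|q\|_{L^2(\Omega)}^2$ over all pairs with $q\in\mathscr K$ and $u$ a solution of $(\mathrm S_{g+q})$, let the costate $p$ be a solution of $(\mathrm S_{u-u_d})$, and assume $q\in H^1(\Omega)$. For a conforming triangulation $\mathcal T_h$ of $\overline\Omega$ with mesh size $h=\max_{K\in\mathcal T_h}\operatorname{diam}K$, let $\mathcal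 V_h$ be the space of continuous functions on $\overline\Omega$ that are affine on each $K\in\mathcal T_h$ and vanish on $\partial\Omega$. With $(\cdot,\cdot)$ the inner product of $L^2(\Omega)$ (or the integral over $\Omega$ of the product), let $$\Lambda_h(u,v)=\frac{\kappa_1}{2\cos(\pi\alpha/2)}\Big\{({}^L_aD_x^{\alpha/2}u,{}^R_xD_b^{\alpha/2}v)+({}^R_xD_b^{\alpha/2}u,{}^L_aD_x^{\alpha/2}v)\Big\}+\frac{\kappa_2}{2\cos(\pi\alpha/2)}\Big\{({}^L_cD_y^{\alpha/2}u,{}^R_yD_d^{\alpha/2}v)+({}^R_yD_d^{\alpha/2}u,{}^L_cD_y^{\alpha/2}v)\Big\}.$$ Let $u_h,p_h\in\mathcal V_h$ and $q_h$ solve the variationally discretized scheme $$\Lambda_h(u_h,\chi_h)=(g+q_h,\chi_h),\qquad \Lambda_h(p_h,\chi_h)=(u_h-u_d,\chi_h)\quad\forall\chi_h\in\mathcal V_h,\qquad q_h=\max\{v_1,\min\{-\tfrac1\gamma p_h,v_2\}\}\ \text{ a.e. in }\Omega,$$ and let $u_h(q),p_h(q)\in\mathcal V_h$ be the discrete state and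 costate driven by the exact control: $$\Lambda_h(u_h(q),\chi_h)=(g+q,\chi_h),\qquad \Lambda_h(p_h(q),\chi_h)=(u_h(q)-u_d,\chi_h)\quad\forall\chi_h\in\mathcal V_h.$$ Then there is a constant $C>0$, independent of the triangulation (in particular of $h$), such that, for every such triangulation and all such discrete solutions, $$\|q-q_h\|_{L^2(\Omega)}\le C\,h+C\,\|p-p_h(q)\|_{L^2(\Omega)}.$$ -/

import Mathlib

open MeasureTheory Filter Topology
open scoped FourierTransform ContDiff

noncomputable section

namespace RieszOCP

/-- Points of the Euclidean plane; `z 0` is the `x`-coordinate and `z 1` the `y`-coordinate. -/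
abbrev Pt : Type := EuclideanSpace ℝ (Fin 2)

/-! ### Riemann–Liouville and Riesz derivatives -/

/-- Left Riemann–Liouville derivative of non-integer order `μ > 0` with base point `a`, where
`n - 1 < μ < n`, i.e. `n = ⌈μ⌉`:
`(1 / Γ(n - μ)) (d/dx)^n ∫_a^x (x - s)^(n - 1 - μ) f(s) ds`. -/
def leftRL (a μ : ℝ) (f : ℝ → ℝ) (x : ℝ) : ℝ :=
  (Real.Gamma ((⌈μ⌉₊ : ℝ) - μ))⁻¹ *
    iteratedDeriv ⌈μ⌉₊ (fun ξ => ∫ s in a..ξ, (ξ - s) ^ ((⌈μ⌉₊ : ℝ) - 1 - μ) * f s) x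

/-- Right Riemann–Liouville derivative of non-integer order `μ > 0` with end point `b`:
`((-1)^n / Γ(n - μ)) (d/dx)^n ∫_x^b (s - x)^(n - 1 - μ) f(s) ds`, `n = ⌈μ⌉`. -/
def rightRL (b μ : ℝ) (f : ℝ → ℝ) (x : ℝ) : ℝ :=
  (-1) ^ ⌈μ⌉₊ * (Real.Gamma ((⌈μ⌉₊ : ℝ) - μ))⁻¹ *
    iteratedDeriv ⌈μ⌉₊ (fun ξ => ∫ s in ξ..b, (s - ξ) ^ ((⌈μ⌉₊ : ℝ) - 1 - μ) * f s) x

/-- The four one-directional Riemann–Liouville derivatives of a function of two variables. -/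
def leftX (a μ : ℝ) (u : Pt → ℝ) (z : Pt) : ℝ := leftRL a μ (fun s => u !₂[s, z 1]) (z 0)

def rightX (b μ : ℝ) (u : Pt → ℝ) (z : Pt) : ℝ := rightRL b μ (fun s => u !₂[s, z 1]) (z 0)

def leftY (c μ : ℝ) (u : Pt → ℝ) (z : Pt) : ℝ := leftRL c μ (fun s => u !₂[z 0, s]) (z 1)

def rightY (d μ : ℝ) (u : Pt → ℝ) (z : Pt) : ℝ := rightRL d μ (fun s => u !₂[z 0, s]) (z 1)

/-- The Riesz derivatives `∂^α u / ∂|x|^α` (on `a < x < b`) and `∂^α u / ∂|y|^α`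
(on `c < y < d`). -/
def rieszX (a b α : ℝ) (u : Pt → ℝ) (z : Pt) : ℝ :=
  (-1) / (2 * Real.cos (Real.pi * α / 2)) * (leftX a α u z + rightX b α u z)

def rieszY (c d α : ℝ) (u : Pt → ℝ) (z : Pt) : ℝ :=
  (-1) / (2 * Real.cos (Real.pi * α / 2)) * (leftY c α u z + rightY d α u z)

/-! ### Function spaces on an open set -/

/-- Real test functions, i.e. elements of `C_0^∞(Ω)`. -/
def IsTest (Ω : Set Pt) (φ : Pt → ℝ) : Prop :=
  ContDiff ℝ ∞ φ ∧ HasCompactSupport φ ∧ tsupport φ ⊆ Ω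

/-- The `L²(Ω)` inner product of real functions. -/
def ip (Ω : Set Pt) (f g : Pt → ℝ) : ℝ := ∫ z in Ω, f z * g z

/-- Membership in `L²(Ω)`. -/
def MemL2 (Ω : Set Pt) (f : Pt → ℝ) : Prop := MemLp f 2 (volume.restrict Ω)

/-- The `L²(Ω)` norm. -/
def normL2 (Ω : Set Pt) (f : Pt → ℝ) : ℝ := (eLpNorm f 2 (volume.restrict Ω)).toReal

/-- The norm `(‖u‖²_{L²(Ω)} + ‖ |k|^μ 𝓕[ũ] ‖²_{L²(ℝ²)})^(1/2)`, as an extended nonnegative number,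
with `ũ` the extension of `u` by zero. The frequency variable is normalized as in Mathlib
(`e^{-2πi⟨z,k⟩}`), which changes the seminorm by a constant factor only. It is used for functions
that are in `L²` of a bounded `Ω`, so `ũ` is integrable. -/
def sobolevENorm (Ω : Set Pt) (μ : ℝ) (u : Pt → ℝ) : ENNReal :=
  (eLpNorm u 2 (volume.restrict Ω) ^ 2 +
    eLpNorm (fun k : Pt =>
      ((‖k‖ ^ μ : ℝ) : ℂ) * 𝓕 (fun z : Pt => ((Ω.indicator u z : ℝ) : ℂ)) k) 2 volume ^ 2)
    ^ (1 / 2 : ℝ)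

/-- `H_0^μ(Ω)`: the closure of `C_0^∞(Ω)` in the fractional Sobolev norm. -/
def MemH0 (Ω : Set Pt) (μ : ℝ) (u : Pt → ℝ) : Prop :=
  MemL2 Ω u ∧ ∃ φ : ℕ → Pt → ℝ, (∀ n, IsTest Ω (φ n)) ∧
    Tendsto (fun n => sobolevENorm Ω μ (fun z => u z - φ n z)) atTop (𝓝 0)

/-- `H^1(Ω)`: square integrable with square integrable weak first derivatives. -/
def MemH1 (Ω : Set Pt) (q : Pt → ℝ) : Prop :=
  MemL2 Ω q ∧ ∀ i : Fin 2, ∃ w : Pt → ℝ, MemL2 Ω w ∧ ∀ φ, IsTest Ω φ →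
    ip Ω q (fun z => fderiv ℝ φ z (EuclideanSpace.single i 1)) = -ip Ω w φ

/-! ### The control problem -/

/-- The data of the optimal control problem on the rectangle `(a,b) × (c,d)`. -/
structure Data where
  (a b c d α κ₁ κ₂ γ v₁ v₂ : ℝ)
  (g ud : Pt → ℝ)
  hab : a < b
  hcd : c < d
  one_lt_α : 1 < α
  α_lt_two : α < 2
  κ₁_pos : 0 < κ₁
  κ₂_pos : 0 < κ₂
  γ_pos : 0 < γ

namespace Data

variable (D : Data)

/-- The open rectangle `Ω = (a,b) × (c,d)`. -/
def Ω : Set Pt := {z | D.a < z 0 ∧ z 0 < D.b ∧ D.c < z 1 ∧ z 1 < D.d}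

/-- The admissible set `{q ∈ L²(Ω) : v₁ ≤ q ≤ v₂ a.e. in Ω}`. -/
def Admissible (q : Pt → ℝ) : Prop :=
  MemL2 D.Ω q ∧ ∀ᵐ z ∂(volume.restrict D.Ω), D.v₁ ≤ q z ∧ q z ≤ D.v₂

/-- The cost `J(u,q) = ½ ‖u - u_d‖² + (γ/2) ‖q‖²`. -/
def J (u q : Pt → ℝ) : ℝ :=
  1 / 2 * normL2 D.Ω (fun z => u z - D.ud z) ^ 2 + D.γ / 2 * normL2 D.Ω q ^ 2

/-- The differential expression `κ₁ ∂^α u/∂|x|^α + κ₂ ∂^α u/∂|y|^α`. -/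
def riesz (u : Pt → ℝ) (z : Pt) : ℝ :=
  D.κ₁ * rieszX D.a D.b D.α u z + D.κ₂ * rieszY D.c D.d D.α u z

/-- `u` is the weak solution of
`σ (κ₁ ∂^α u/∂|x|^α + κ₂ ∂^α u/∂|y|^α) = f` in `Ω`, `u = 0` on `∂Ω`: the function `u` belongs to
`H_0^{α/2}(Ω)` and the equation holds in the sense of distributions on `Ω` (the formal adjoint of
each Riesz derivative is the same Riesz derivative). -/
def IsSolution (σ : ℝ) (f u : Pt → ℝ) : Prop :=
  MemH0 D.Ω (D.α / 2) u ∧ ∀ φ, IsTest D.Ω φ → ip D.Ω u (fun z => σ * D.riesz φ z) = ip D.Ω f φ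

/-- `(q, u)` minimizes `J` over all admissible controls and their states. -/
def IsOptimal (σ : ℝ) (q u : Pt → ℝ) : Prop :=
  D.Admissible q ∧ D.IsSolution σ (fun z => D.g z + q z) u ∧
    ∀ q' u' : Pt → ℝ, D.Admissible q' → D.IsSolution σ (fun z => D.g z + q' z) u' →
      D.J u q ≤ D.J u' q'

/-- `p` is the costate belonging to the state `u`: it solves the adjoint equation with right-hand
side `u - u_d`. -/
def IsCostate (σ : ℝ) (u p : Pt → ℝ) : Prop :=
  D.IsSolution σ (fun z => u z - D.ud z) p

/-! ### The finite element scheme -/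

/-- A conforming triangulation of the closed rectangle: finitely many nondegenerate closed
triangles, each given by its three vertices, that cover the closed rectangle, any two of
which meet exactly in the convex hull of their common vertices. -/
structure Mesh where
  tri : Finset (Finset Pt)
  card_eq : ∀ t ∈ tri, t.card = 3
  affineIndep : ∀ t ∈ tri, AffineIndependent ℝ ((↑) : t → Pt)
  cover : ⋃ t ∈ tri, convexHull ℝ (t : Set Pt) = closure D.Ω
  inter : ∀ s ∈ tri, ∀ t ∈ tri,
    convexHull ℝ (s : Set Pt) ∩ convexHull ℝ (t : Set Pt) ⊆
      convexHull ℝ ((s : Set Pt) ∩ (t : Set Pt))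

variable {D} in
/-- The mesh size `h = max_K diam K`. -/
def Mesh.h (T : D.Mesh) : ℝ := ⨆ t : T.tri, Metric.diam (convexHull ℝ ((t : Finset Pt) : Set Pt))

variable {D} in
/-- The space of continuous piecewise linear functions that vanish on `∂Ω` (extended by zero
outside `Ω`). -/
def Mesh.MemV (T : D.Mesh) (v : Pt → ℝ) : Prop :=
  Continuous v ∧ (∀ z, z ∉ D.Ω → v z = 0) ∧
    ∀ t ∈ T.tri, ∃ m₀ m₁ k : ℝ, ∀ z ∈ convexHull ℝ (t : Set Pt), v z = m₀ * z 0 + m₁ * z 1 + k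

/-- The bilinear form `Λ_h`. -/
def Λ (u v : Pt → ℝ) : ℝ :=
  D.κ₁ / (2 * Real.cos (Real.pi * D.α / 2)) *
      (ip D.Ω (leftX D.a (D.α / 2) u) (rightX D.b (D.α / 2) v) +
        ip D.Ω (rightX D.b (D.α / 2) u) (leftX D.a (D.α / 2) v)) +
    D.κ₂ / (2 * Real.cos (Real.pi * D.α / 2)) *
      (ip D.Ω (leftY D.c (D.α / 2) u) (rightY D.d (D.α / 2) v) +
        ip D.Ω (rightY D.d (D.α / 2) u) (leftY D.c (D.α / 2) v))

variable {D} in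
/-- `w` is the Galerkin solution with right-hand side `f`:
`Λ_h(w, χ) = (f, χ)` for all `χ` in the finite element space. -/
def Mesh.IsGalerkin (T : D.Mesh) (f w : Pt → ℝ) : Prop :=
  T.MemV w ∧ ∀ χ, T.MemV χ → D.Λ w χ = ip D.Ω f χ

variable {D} in
/-- `(q_h, p_h, u_h)` solves the variationally discretized scheme: discrete state equation,
discrete costate equation, and `q_h = max {v₁, min {-p_h/γ, v₂}}`. -/
def Mesh.IsDiscreteSolution (T : D.Mesh) (qh ph uh : Pt → ℝ) : Prop :=
  T.IsGalerkin (fun z => D.g z + qh z) uh ∧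
    T.IsGalerkin (fun z => uh z - D.ud z) ph ∧
    ∀ᵐ z ∂(volume.restrict D.Ω), qh z = max D.v₁ (min (-(1 / D.γ) * ph z) D.v₂)

end Data

end RieszOCP

end

/-! Three inequalities give the estimate. Optimality of `q`, tested with `q_h`, gives `(γq + p, q_h
- q) ≥ 0`. The projection formula for `q_h`, tested with `q`, gives `(γq_h + p_h, q - q_h) ≥ 0`. The
Galerkin control-to-costate map is monotone: `(p_h(q) - p_h, q_h - q) = -‖u_h(q) - u_h‖² ≤ 0`.
Adding them yields `γ‖q - q_h‖² ≤ (p_h(q) - p, q - q_h)`, and Cauchy–Schwarz gives `‖q - q_h‖ ≤ ‖p -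
p_h(q)‖ / γ`. The nonnegative term in `h` is then added for free.

The discrete inequalities (`nonneg_mul_sub_of_eq_proj`, `Mesh.ip_costate_sub_control_nonpos`) use
only the projection formula and the symmetry of `Λ`. The work lies in
`IsOptimal.variational_inequality`, which differentiates `J` along `u + t w`, where `w` is the state
driven by `q' - q`. This needs such a `w` to exist (`exists_isSolution`) and the adjoint identity
`(u - u_d, w) = (q' - q, p)` (`IsSolution.ip_comm`).

Both come from the Fourier side. On test functions the operator is minus a multiplier with symbol
`M(k)` comparable to `|k|^α` (`exists_isSymbol`), because the sum of the two Riemann–Liouville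
derivatives is a convolution of `f''` with `|t|^(1-α)`, whose transform is a positive multiple of
`|ξ|^(α-2)`. The weak equation therefore reads `-σ E(v, φ) = (f, φ)` with the symmetric form `E(v,
w) = Re ∫ M v̂ conj(ŵ)`. A Poincaré inequality makes `E` coercive on `H_0^{α/2}(Ω)`, Lax–Milgram
gives existence, and density of test functions gives the adjoint identity. -/

namespace RieszOCP
open Set
open scoped SchwartzMap LineDeriv

/-! ### Riemann–Liouville derivatives of test functions as convolutions -/

/-- The kernel `|t|^r` with `-1 < r < 0` is locally integrable on the line. -/
theorem locallyIntegrable_abs_rpow {r : ℝ} (hr : -1 < r) :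
    LocallyIntegrable (fun t : ℝ => |t| ^ r) := by
  have h1 : ∀ b : ℝ, 0 ≤ b → IntervalIntegrable (fun t : ℝ => |t| ^ r) volume 0 b := by
    intro b hb
    refine (intervalIntegral.intervalIntegrable_rpow' hr).congr ?_
    intro t ht
    rw [uIoc_of_le hb] at ht
    simp [abs_of_pos ht.1]
  have h2 : ∀ b : ℝ, 0 ≤ b → IntervalIntegrable (fun t : ℝ => |t| ^ r) volume (-b) b := by
    intro b hb
    have := ((IntervalIntegrable.iff_comp_neg (by simp)).mp (h1 b hb)).symm
    simp only [abs_neg, neg_zero] at this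
    exact this.trans (h1 b hb)
  rw [locallyIntegrable_iff]
  intro K hK
  obtain ⟨R, hR⟩ := hK.isBounded.subset_closedBall 0
  have hR0 : 0 ≤ max R 0 := le_max_right _ _
  have := ((intervalIntegrable_iff_integrableOn_Icc_of_le (by linarith)).mp (h2 _ hR0))
  refine this.mono_set fun t ht => ?_
  have := hR ht
  rw [Metric.mem_closedBall, dist_zero_right, Real.norm_eq_abs, abs_le] at this
  have h3 := le_max_left R 0
  exact ⟨by linarith, by linarith⟩

/-- A one-sided power kernel convolved with a smooth compactly supported function may be
differentiated twice under the integral sign. -/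
theorem iteratedDeriv_two_convolution {k f : ℝ → ℝ} (hk : LocallyIntegrable k)
    (hf : ContDiff ℝ ∞ f) (hc : HasCompactSupport f) (x : ℝ) :
    iteratedDeriv 2 (fun ξ => ∫ t, k t * f (ξ - t)) x = ∫ t, k t * deriv (deriv f) (x - t) := by
  have key : ∀ g : ℝ → ℝ, ContDiff ℝ ∞ g → HasCompactSupport g →
      deriv (fun ξ => ∫ t, k t * g (ξ - t)) = fun ξ => ∫ t, k t * deriv g (ξ - t) := by
    intro g hg hgc
    funext y
    exact (hgc.hasDerivAt_convolution_right (ContinuousLinearMap.lsmul ℝ ℝ) hk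
      (hg.of_le (by exact_mod_cast le_top)) y).deriv
  rw [iteratedDeriv_succ, iteratedDeriv_one, key f hf hc,
    key (deriv f) ((contDiff_infty_iff_deriv.mp hf).2) hc.deriv]

theorem integrable_abs_rpow_mul_comp_sub {r : ℝ} (hr : -1 < r) {g : ℝ → ℝ}
    (hg : Continuous g) (hc : HasCompactSupport g) (x : ℝ) :
    Integrable (fun t : ℝ => |t| ^ r * g (x - t)) := by
  have h := (locallyIntegrable_abs_rpow hr).integrable_smul_right_of_hasCompactSupport
    (g := fun t => g (x - t)) (by fun_prop)
    (hc.comp_homeomorph (Homeomorph.subLeft x))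
  simpa [smul_eq_mul] using h

/-- Since `f` vanishes off `(a, b)`, the two integrals are convolutions of `f` with the halves of
`|t|^(1-α)` on `t > 0` and `t ≤ 0`. Both derivatives fall on `f`, the sign `(-1)^2` is `1`, and the
halves add up to the even kernel. -/
theorem leftRL_add_rightRL {a b α : ℝ} (h1 : 1 < α) (h2 : α < 2) {f : ℝ → ℝ}
    (hf : ContDiff ℝ ∞ f) (hs : tsupport f ⊆ Ioo a b) {x : ℝ} (hx : x ∈ Ioo a b) :
    leftRL a α f x + rightRL b α f x =
      (Real.Gamma (2 - α))⁻¹ * ∫ t, |t| ^ (1 - α) * deriv (deriv f) (x - t) := by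
  have hceil : ⌈α⌉₊ = 2 := by
    rw [Nat.ceil_eq_iff (by norm_num)]
    constructor <;> norm_num <;> linarith
  have hc : HasCompactSupport f :=
    HasCompactSupport.of_support_subset_isCompact isCompact_Icc
      ((subset_tsupport f).trans (hs.trans Ioo_subset_Icc_self))
  have hzero : ∀ s, s ∉ Ioo a b → f s = 0 := fun s h =>
    image_eq_zero_of_notMem_tsupport fun h' => h (hs h')
  have habs := locallyIntegrable_abs_rpow (r := 1 - α) (by linarith)
  set kl : ℝ → ℝ := (Ioi 0).indicator fun t => |t| ^ (1 - α) with hkl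
  set kr : ℝ → ℝ := (Iic 0).indicator fun t => |t| ^ (1 - α) with hkr
  have hkl' : LocallyIntegrable kl := habs.indicator measurableSet_Ioi
  have hkr' : LocallyIntegrable kr := habs.indicator measurableSet_Iic
  -- The convolution formula is needed only for `ξ > a`, which holds near `x`; the derivative at `x`
  -- sees no more.
  have hL : (fun ξ => ∫ s in a..ξ, (ξ - s) ^ ((2 : ℝ) - 1 - α) * f s) =ᶠ[𝓝 x]
      fun ξ => ∫ t, kl t * f (ξ - t) := by
    filter_upwards [Ioi_mem_nhds hx.1] with ξ hξ
    rw [intervalIntegral.integral_of_le (le_of_lt hξ),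
      ← integral_indicator measurableSet_Ioc,
      ← integral_sub_left_eq_self (fun t => kl t * f (ξ - t)) volume ξ]
    refine integral_congr_ae ?_
    filter_upwards [compl_mem_ae_iff.mpr (measure_singleton ξ)] with s hsne
    simp only [hkl, indicator_apply, sub_sub_cancel, mem_Ioc, mem_Ioi, sub_pos]
    by_cases h : a < s
    · rcases lt_trichotomy s ξ with h' | h' | h'
      · rw [if_pos ⟨h, h'.le⟩, if_pos h', abs_of_pos (sub_pos.mpr h')]; norm_num
      · exact absurd h' hsne
      · rw [if_neg (fun hh => absurd hh.2 (not_le.mpr h')), if_neg (not_lt.mpr h'.le), zero_mul]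
    · rw [hzero s fun hh => h hh.1]; simp
  have hR : (fun ξ => ∫ s in ξ..b, (s - ξ) ^ ((2 : ℝ) - 1 - α) * f s) =ᶠ[𝓝 x]
      fun ξ => ∫ t, kr t * f (ξ - t) := by
    filter_upwards [Iio_mem_nhds hx.2] with ξ hξ
    rw [intervalIntegral.integral_of_le (le_of_lt hξ),
      ← integral_indicator measurableSet_Ioc,
      ← integral_sub_left_eq_self (fun t => kr t * f (ξ - t)) volume ξ]
    refine integral_congr_ae ?_
    filter_upwards [compl_mem_ae_iff.mpr (measure_singleton ξ)] with s hsne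
    simp only [hkr, indicator_apply, sub_sub_cancel, mem_Ioc, mem_Iic, sub_nonpos]
    by_cases h : s < b
    · rcases lt_trichotomy s ξ with h' | h' | h'
      · rw [if_neg (fun hh => absurd hh.1 h'.not_gt), if_neg (not_le.mpr h'), zero_mul]
      · exact absurd h' hsne
      · rw [if_pos ⟨h', h.le⟩, if_pos h'.le, abs_sub_comm, abs_of_pos (sub_pos.mpr h')]; norm_num
    · rw [hzero s fun hh => h hh.2]; simp
  have hd : Continuous (deriv (deriv f)) :=
    ((contDiff_infty_iff_deriv.mp (contDiff_infty_iff_deriv.mp hf).2).2).continuous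
  have hint := integrable_abs_rpow_mul_comp_sub (r := 1 - α) (by linarith) hd hc.deriv.deriv x
  have il : Integrable fun t => kl t * deriv (deriv f) (x - t) := by
    refine (hint.indicator (measurableSet_Ioi (a := (0:ℝ)))).congr (ae_of_all _ fun t => ?_)
    by_cases h : t ∈ Ioi (0:ℝ) <;> simp only [hkl, indicator, h] <;> simp
  have ir : Integrable fun t => kr t * deriv (deriv f) (x - t) := by
    refine (hint.indicator (measurableSet_Iic (a := (0:ℝ)))).congr (ae_of_all _ fun t => ?_)
    by_cases h : t ∈ Iic (0:ℝ) <;> simp only [hkr, indicator, h] <;> simp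
  rw [leftRL, rightRL, hceil]
  push_cast
  rw [hL.iteratedDeriv_eq, hR.iteratedDeriv_eq, iteratedDeriv_two_convolution hkl' hf hc,
    iteratedDeriv_two_convolution hkr' hf hc]
  rw [show ((-1 : ℝ) ^ 2) = 1 by norm_num, one_mul, ← mul_add, ← integral_add il ir]
  congr 2
  funext t
  by_cases h : 0 < t
  · simp [hkl, hkr, h, not_le.mpr h]
  · simp [hkl, hkr, h, not_lt.mp h]

/-! ### The Fourier transform of `|t|^{-s}` by superposition of Gaussians -/

/-- The power `|t|^{-s}` as a superposition of Gaussians. -/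
theorem integral_rpow_mul_exp_neg_mul_sq {s t : ℝ} (hs : 0 < s) (ht : t ≠ 0) :
    ∫ l in Ioi (0 : ℝ), l ^ (s / 2 - 1) * Real.exp (-(l * t ^ 2)) =
      Real.Gamma (s / 2) * |t| ^ (-s) := by
  have h := Real.integral_rpow_mul_exp_neg_mul_Ioi (half_pos hs) (sq_pos_of_ne_zero ht)
  simp only [mul_comm _ (t ^ 2)]
  rw [h, mul_comm, ← sq_abs, one_div, ← Real.rpow_natCast, ← Real.rpow_neg (abs_nonneg t),
    ← Real.rpow_mul (abs_nonneg t)]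
  congr 2
  push_cast; ring

/-- The substitution `y = 1 / l` turns this into a Gamma integral. -/
theorem integral_rpow_mul_exp_neg_div {s b : ℝ} (hs : s < 1) (hb : 0 < b) :
    IntegrableOn (fun l : ℝ => l ^ ((s - 3) / 2) * Real.exp (-(b / l))) (Ioi 0) ∧
    ∫ l in Ioi (0 : ℝ), l ^ ((s - 3) / 2) * Real.exp (-(b / l)) =
      (1 / b) ^ ((1 - s) / 2) * Real.Gamma ((1 - s) / 2) := by
  have hpos : 0 < (1 - s) / 2 := by linarith
  have e : ∀ l ∈ Ioi (0 : ℝ), (|(-1 : ℝ)| * l ^ ((-1 : ℝ) - 1)) •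
      ((l ^ (-1 : ℝ)) ^ ((1 - s) / 2 - 1) * Real.exp (-(b * l ^ (-1 : ℝ)))) =
      l ^ ((s - 3) / 2) * Real.exp (-(b / l)) := by
    intro l hl
    have hl : 0 < l := hl
    rw [← Real.rpow_mul hl.le, smul_eq_mul, abs_neg, abs_one, one_mul, ← mul_assoc,
      ← Real.rpow_add hl, Real.rpow_neg_one, div_eq_mul_inv]
    congr 2
    ring
  constructor
  · refine IntegrableOn.congr_fun ?_ e measurableSet_Ioi
    rw [integrableOn_Ioi_comp_rpow_iff
      (fun y : ℝ => y ^ ((1 - s) / 2 - 1) * Real.exp (-(b * y))) (by norm_num)]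
    have := integrableOn_rpow_mul_exp_neg_mul_rpow (p := 1) (s := (1 - s) / 2 - 1) (b := b)
      (by linarith) (by norm_num) hb
    simpa using this
  · rw [← setIntegral_congr_fun measurableSet_Ioi e, integral_comp_rpow_Ioi
      (fun y : ℝ => y ^ ((1 - s) / 2 - 1) * Real.exp (-(b * y))) (by norm_num),
      Real.integral_rpow_mul_exp_neg_mul_Ioi hpos hb]

theorem integral_gaussian_mul_exp {l : ℝ} (hl : 0 < l) (x : ℝ) :
    ∫ t : ℝ, ((Real.exp (-(l * t ^ 2)) : ℝ) : ℂ) * Complex.exp (-(2 * Real.pi * x * t) * Complex.I) =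
      ((Real.sqrt Real.pi * l ^ (-(1 / 2) : ℝ) * Real.exp (-(Real.pi ^ 2 * x ^ 2 / l)) : ℝ) : ℂ) := by
  have h := fourierIntegral_gaussian (b := (l : ℂ)) (by simpa using hl) (-(2 * Real.pi * x))
  have e1 : ((Real.pi : ℂ) / l) ^ (1 / 2 : ℂ) = ((Real.sqrt Real.pi * l ^ (-(1 / 2) : ℝ) : ℝ) : ℂ) := by
    rw [← Complex.ofReal_div, show (1 / 2 : ℂ) = ((1 / 2 : ℝ) : ℂ) by push_cast; rfl,
      ← Complex.ofReal_cpow (by positivity), Real.div_rpow Real.pi_pos.le hl.le,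
      Real.rpow_neg hl.le, Real.sqrt_eq_rpow]
    rfl
  rw [e1] at h
  calc _ = ∫ t : ℝ, Complex.exp (Complex.I * (-(2 * Real.pi * x)) * t) *
        Complex.exp (-l * t ^ 2) := by
        refine integral_congr_ae (ae_of_all _ fun t => ?_)
        simp only
        rw [mul_comm, Complex.ofReal_exp]
        congr 2
        · ring
        · push_cast; ring
    _ = _ := by
        rw [h, Complex.ofReal_mul _ (Real.exp _), Complex.ofReal_exp]
        congr 2
        push_cast
        have : (l : ℂ) ≠ 0 := by exact_mod_cast hl.ne'
        field_simp
        ring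

/-- The Fourier transform of `|t|^{-s}`, `0 < s < 1`, is a positive multiple of `|ξ|^{s-1}`;
tested against the Fourier transform of a finite complex measure on the line, presented as the
image of a density `G` under `ℓ`. -/
theorem integral_abs_rpow_mul_integral_exp {s : ℝ} (hs0 : 0 < s) (hs1 : s < 1) :
    ∃ c : ℝ, 0 < c ∧ ∀ (ℓ : Pt → ℝ) (G : Pt → ℂ), Measurable ℓ → Integrable G →
      Integrable (fun k => ((|ℓ k| ^ (s - 1) : ℝ) : ℂ) * G k) → (∀ k, ℓ k = 0 → G k = 0) →
      Integrable (fun t : ℝ => ((|t| ^ (-s) : ℝ) : ℂ) *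
        ∫ k, G k * Complex.exp (-(2 * Real.pi * ℓ k * t) * Complex.I)) →
      ∫ t : ℝ, ((|t| ^ (-s) : ℝ) : ℂ) *
        ∫ k, G k * Complex.exp (-(2 * Real.pi * ℓ k * t) * Complex.I) =
      c * ∫ k, ((|ℓ k| ^ (s - 1) : ℝ) : ℂ) * G k := by
  have hΓ := Real.Gamma_pos_of_pos (half_pos hs0)
  have hΓ' := Real.Gamma_pos_of_pos (show 0 < (1 - s) / 2 by linarith)
  set K : ℝ := Real.sqrt Real.pi * (Real.pi ^ (s - 1) * Real.Gamma ((1 - s) / 2)) with hK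
  have hKpos : 0 < K := by have := Real.pi_pos; positivity
  refine ⟨K / Real.Gamma (s / 2), by positivity, fun ℓ G hℓ hG hG' hG0 hint => ?_⟩
  set E : ℝ → Pt → ℂ := fun t k => Complex.exp (-(2 * Real.pi * ℓ k * t) * Complex.I) with hE
  have hEn : ∀ t k, ‖E t k‖ = 1 := by
    intro t k
    have : E t k = Complex.exp ((-(2 * Real.pi * ℓ k * t) : ℝ) * Complex.I) := by
      simp [hE]
    rw [this, Complex.norm_exp_ofReal_mul_I]
  have hEm : Measurable (fun p : ℝ × Pt => E p.1 p.2) := by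
    simp only [hE]; fun_prop
  set h : ℝ → ℂ := fun t => ∫ k, G k * E t k with hh
  have hhc : Continuous h := by
    refine continuous_of_dominated (bound := fun k => ‖G k‖) (fun t => ?_) (fun t => ?_) hG.norm ?_
    · exact hG.1.mul (hEm.comp measurable_prodMk_left).aestronglyMeasurable
    · exact ae_of_all _ fun k => by rw [norm_mul, hEn, mul_one]
    · refine ae_of_all _ fun k => ?_
      simp only [hE]; fun_prop
  -- Integrating `W t l` over `l` gives `Γ(s/2) |t|^{-s}`. `V l k` is the Fourier transform of `W ·
  -- l` at frequency `ℓ k`; the Gaussian contributes `l^(-1/2)`, so the exponent is `s/2 - 1 - 1/2 =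
  -- (s - 3)/2`. Integrating `V l k` over `l` gives `K |ℓ k|^(s-1)`.
  set W : ℝ → ℝ → ℝ := fun t l => l ^ (s / 2 - 1) * Real.exp (-(l * t ^ 2)) with hW
  set V : ℝ → Pt → ℝ := fun l k =>
    Real.sqrt Real.pi * (l ^ ((s - 3) / 2) * Real.exp (-(Real.pi ^ 2 * ℓ k ^ 2 / l))) with hV
  have hWm : Measurable (fun p : ℝ × ℝ => W p.1 p.2) := by simp only [hW]; fun_prop
  have hVm : Measurable (fun p : ℝ × Pt => V p.1 p.2) := by simp only [hV]; fun_prop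
  have hWi : ∀ t, t ≠ 0 → Integrable (W t) (volume.restrict (Ioi 0)) := by
    intro t ht
    have := integrableOn_rpow_mul_exp_neg_mul_rpow (p := 1) (s := s / 2 - 1) (b := t ^ 2)
      (by linarith) (by norm_num) (by positivity)
    refine Integrable.congr this (ae_of_all _ fun l => ?_)
    simp [hW, mul_comm]
  have hne : ∀ᵐ t : ℝ, t ≠ 0 := compl_mem_ae_iff.mpr (measure_singleton 0)
  -- the kernel as a superposition of Gaussians
  have step1 : ∀ᵐ t : ℝ, ∫ l in Ioi (0 : ℝ), (W t l : ℂ) * h t =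
      (Real.Gamma (s / 2) : ℂ) * (((|t| ^ (-s) : ℝ) : ℂ) * h t) := by
    filter_upwards [hne] with t ht
    rw [integral_mul_const, integral_complex_ofReal, integral_rpow_mul_exp_neg_mul_sq hs0 ht]
    push_cast; ring
  have swap1 : Integrable (fun p : ℝ × ℝ => (W p.1 p.2 : ℂ) * h p.1)
      ((volume : Measure ℝ).prod (volume.restrict (Ioi 0))) := by
    rw [integrable_prod_iff]
    · refine ⟨?_, ?_⟩
      · filter_upwards [hne] with t ht
        exact (hWi t ht).ofReal.mul_const _
      · refine (hint.norm.const_mul (Real.Gamma (s / 2))).congr ?_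
        filter_upwards [hne] with t ht
        have : ∫ l in Ioi (0 : ℝ), ‖(W t l : ℂ) * h t‖ = ∫ l in Ioi (0 : ℝ), W t l * ‖h t‖ := by
          refine setIntegral_congr_fun measurableSet_Ioi fun l hl => ?_
          have hl : 0 < l := hl
          have : 0 ≤ W t l := by simp only [hW]; positivity
          simp only [norm_mul, Complex.norm_real, Real.norm_eq_abs, abs_of_nonneg this]
        rw [this, integral_mul_const, integral_rpow_mul_exp_neg_mul_sq hs0 ht, norm_mul,
          Complex.norm_real, Real.norm_eq_abs, abs_of_nonneg (by positivity)]
        ring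
    · exact ((Complex.measurable_ofReal.comp hWm).mul
        (hhc.measurable.comp measurable_fst)).aestronglyMeasurable
  -- the transform of a single Gaussian
  have step2 : ∀ l ∈ Ioi (0 : ℝ), ∫ t, (W t l : ℂ) * h t = ∫ k, (V l k : ℂ) * G k := by
    intro l hl
    have hl : 0 < l := hl
    have hWt : Integrable (fun t => (W t l : ℂ)) := by
      have := ((integrable_exp_neg_mul_sq hl).const_mul (l ^ (s / 2 - 1))).ofReal (𝕜 := ℂ)
      simpa [hW] using this
    have hi : Integrable (fun p : ℝ × Pt => (W p.1 l : ℂ) * (G p.2 * E p.1 p.2))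
        ((volume : Measure ℝ).prod volume) := by
      refine (hWt.mul_prod hG).mono ?_ ?_
      · exact ((hWt.1.comp_fst).mul (hG.1.comp_snd.mul hEm.aestronglyMeasurable))
      · refine ae_of_all _ fun p => ?_
        simp only [norm_mul, hEn, mul_one]; exact le_rfl
    calc ∫ t, (W t l : ℂ) * h t = ∫ t, ∫ k, (W t l : ℂ) * (G k * E t k) := by
          simp only [hh, integral_const_mul]
      _ = ∫ k, ∫ t, (W t l : ℂ) * (G k * E t k) := integral_integral_swap hi
      _ = _ := by
          refine integral_congr_ae (ae_of_all _ fun k => ?_)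
          have : ∀ t, (W t l : ℂ) * (G k * E t k) = (G k * ((l ^ (s / 2 - 1) : ℝ) : ℂ)) *
              (((Real.exp (-(l * t ^ 2)) : ℝ) : ℂ) * E t k) := by
            intro t; simp only [hW]; push_cast; ring
          simp only [this]
          rw [integral_const_mul, integral_gaussian_mul_exp hl]
          have e : V l k = l ^ (s / 2 - 1) *
              (Real.sqrt Real.pi * l ^ (-(1 / 2) : ℝ) *
                Real.exp (-(Real.pi ^ 2 * ℓ k ^ 2 / l))) := by
            simp only [hV]
            rw [show (s - 3) / 2 = (s / 2 - 1) + (-(1 / 2)) by ring, Real.rpow_add hl]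
            ring
          rw [e]
          push_cast; ring
  have hVint : ∀ k, ℓ k ≠ 0 → Integrable (fun l => V l k) (volume.restrict (Ioi 0)) ∧
      ∫ l in Ioi (0 : ℝ), V l k = K * |ℓ k| ^ (s - 1) := by
    intro k hk
    have hb : 0 < Real.pi ^ 2 * ℓ k ^ 2 := by have := Real.pi_pos; positivity
    obtain ⟨i1, i2⟩ := integral_rpow_mul_exp_neg_div hs1 hb
    refine ⟨Integrable.const_mul i1 _, ?_⟩
    simp only [hV]
    rw [integral_const_mul, i2, hK]
    have : (1 / (Real.pi ^ 2 * ℓ k ^ 2)) ^ ((1 - s) / 2) = Real.pi ^ (s - 1) * |ℓ k| ^ (s - 1) := by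
      rw [← Real.mul_rpow Real.pi_pos.le (abs_nonneg _), ← sq_abs (ℓ k), ← mul_pow, one_div,
        ← Real.rpow_natCast, ← Real.rpow_neg (by positivity), ← Real.rpow_mul (by positivity)]
      congr 1
      push_cast; ring
    rw [this]; ring
  -- On `ℓ k = 0` the integral of `V` over `l` diverges; there the vanishing of `G` is what saves
  -- both the identity and Fubini.
  have step3 : ∀ k, ∫ l in Ioi (0 : ℝ), (V l k : ℂ) * G k =
      (K : ℂ) * (((|ℓ k| ^ (s - 1) : ℝ) : ℂ) * G k) := by
    intro k
    by_cases hk : ℓ k = 0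
    · simp [hG0 k hk]
    · rw [integral_mul_const, integral_complex_ofReal, (hVint k hk).2]
      push_cast; ring
  have swap2 : Integrable (fun p : ℝ × Pt => (V p.1 p.2 : ℂ) * G p.2)
      ((volume.restrict (Ioi (0 : ℝ))).prod volume) := by
    rw [integrable_prod_iff']
    · refine ⟨ae_of_all _ fun k => ?_, ?_⟩
      · by_cases hk : ℓ k = 0
        · simp [hG0 k hk]
        · exact (hVint k hk).1.ofReal.mul_const (G k)
      · refine (hG'.norm.const_mul K).congr (ae_of_all _ fun k => ?_)
        by_cases hk : ℓ k = 0
        · simp [hG0 k hk]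
        have : ∫ l in Ioi (0 : ℝ), ‖(V l k : ℂ) * G k‖ = ∫ l in Ioi (0 : ℝ), V l k * ‖G k‖ := by
          refine setIntegral_congr_fun measurableSet_Ioi fun l hl => ?_
          have hl : 0 < l := hl
          have : 0 ≤ V l k := by simp only [hV]; positivity
          simp only [norm_mul, Complex.norm_real, Real.norm_eq_abs, abs_of_nonneg this]
        simp only
        rw [this, integral_mul_const, (hVint k hk).2, norm_mul, Complex.norm_real,
          Real.norm_eq_abs, abs_of_nonneg (by positivity)]
        ring
    · exact (Complex.measurable_ofReal.comp hVm).aestronglyMeasurable.mul hG.1.comp_snd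
  have total : (Real.Gamma (s / 2) : ℂ) * ∫ t : ℝ, ((|t| ^ (-s) : ℝ) : ℂ) * h t =
      (K : ℂ) * ∫ k, ((|ℓ k| ^ (s - 1) : ℝ) : ℂ) * G k := by
    rw [← integral_const_mul, ← integral_congr_ae step1, integral_integral_swap swap1,
      setIntegral_congr_fun measurableSet_Ioi step2, integral_integral_swap swap2,
      ← integral_const_mul]
    exact integral_congr_ae (ae_of_all _ step3)
  have hΓc : (Real.Gamma (s / 2) : ℂ) ≠ 0 := by exact_mod_cast hΓ.ne'
  rw [eq_comm, Complex.ofReal_div, div_mul_eq_mul_div, div_eq_iff hΓc, ← total]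
  ring

/-! ### The Riesz derivative of a test function as a Fourier multiplier -/

/-- The Schwartz function given by a test function. -/
noncomputable def IsTest.toSchwartz {Ω : Set Pt} {φ : Pt → ℝ} (h : IsTest Ω φ) : 𝓢(Pt, ℂ) :=
  HasCompactSupport.toSchwartzMap (f := fun z => (φ z : ℂ))
    (h.2.1.comp_left Complex.ofReal_zero) (Complex.ofRealCLM.contDiff.comp h.1)

theorem IsTest.toSchwartz_apply {Ω : Set Pt} {φ : Pt → ℝ} (h : IsTest Ω φ) (z : Pt) :
    h.toSchwartz z = (φ z : ℂ) := rfl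

theorem abs_rpow_le_one_add_sq {α : ℝ} (h0 : 0 ≤ α) (h2 : α ≤ 2) {x y : ℝ} (hx : |x| ≤ y) :
    |x| ^ α ≤ 1 + y ^ 2 := by
  have hy : 0 ≤ y := (abs_nonneg x).trans hx
  rcases le_total y 1 with h | h
  · have := Real.rpow_le_one (abs_nonneg x) (hx.trans h) h0
    nlinarith
  · have h1 := Real.rpow_le_rpow (abs_nonneg x) hx h0
    have h3 := Real.rpow_le_rpow_of_exponent_le h h2
    rw [Real.rpow_two] at h3
    linarith

theorem integrable_abs_rpow_mul_schwartz {α : ℝ} (h0 : 0 ≤ α) (h2 : α ≤ 2) (Ψ : 𝓢(Pt, ℂ))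
    {ℓ : Pt → ℝ} (hm : Measurable ℓ) (hℓ : ∀ k, |ℓ k| ≤ ‖k‖) :
    Integrable (fun k : Pt => ((|ℓ k| ^ α : ℝ) : ℂ) * Ψ k) := by
  have i1 := (SchwartzMap.integrable_pow_mul volume Ψ 0).add
    (SchwartzMap.integrable_pow_mul volume Ψ 2)
  refine i1.mono ?_ (ae_of_all _ fun k => ?_)
  · have : Measurable (fun k : Pt => ((|ℓ k| ^ α : ℝ) : ℂ)) := by fun_prop
    exact this.aestronglyMeasurable.mul Ψ.continuous.aestronglyMeasurable
  · have := abs_rpow_le_one_add_sq h0 h2 (hℓ k)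
    simp only [Pi.add_apply, pow_zero, one_mul, norm_mul, Complex.norm_real, Real.norm_eq_abs]
    rw [abs_of_nonneg (show 0 ≤ |ℓ k| ^ α by positivity),
      abs_of_nonneg (show 0 ≤ ‖Ψ k‖ + ‖k‖ ^ 2 * ‖Ψ k‖ by positivity)]
    nlinarith [norm_nonneg (Ψ k)]

theorem fourier_lineDeriv_lineDeriv (Φ : 𝓢(Pt, ℂ)) (i : Fin 2) (k : Pt) :
    𝓕 (∂_{(EuclideanSpace.single i 1 : Pt)} (∂_{(EuclideanSpace.single i 1 : Pt)} Φ)) k =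
      -((4 * Real.pi ^ 2 * (k i) ^ 2 : ℝ) : ℂ) * 𝓕 Φ k := by
  set m : Pt := EuclideanSpace.single i 1 with hm
  have : (inner ℝ · m : Pt → ℝ).HasTemperateGrowth :=
    ((innerSL ℝ).flip m).hasTemperateGrowth
  have hk : inner ℝ k m = k i := by simp [hm, EuclideanSpace.inner_single_right]
  rw [SchwartzMap.fourier_lineDerivOp_eq, SchwartzMap.fourier_lineDerivOp_eq]
  simp [SchwartzMap.smulLeftCLM_apply_apply this, hk]
  ring_nf
  simp

/-- Fourier inversion writes the second derivative at `z - t m` as a superposition of exponentials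
in `t` with frequency `k i`. The kernel then contributes `|k i|^(α-2)` and the two derivatives
contribute `-4π² (k i)²`, whose product is a negative multiple of `|k i|^α`. Working with the
transform on the plane avoids slicing it into one-dimensional ones. -/
theorem integral_abs_rpow_mul_lineDeriv {α : ℝ} (h1 : 1 < α) (h2 : α < 2) :
    ∃ c : ℝ, 0 < c ∧ ∀ (Φ : 𝓢(Pt, ℂ)) (i : Fin 2) (z : Pt),
      Integrable (fun t : ℝ => ((|t| ^ (1 - α) : ℝ) : ℂ) *
        (∂_{(EuclideanSpace.single i 1 : Pt)} (∂_{(EuclideanSpace.single i 1 : Pt)} Φ))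
          (z - t • EuclideanSpace.single i 1)) →
      ∫ t : ℝ, ((|t| ^ (1 - α) : ℝ) : ℂ) *
        (∂_{(EuclideanSpace.single i 1 : Pt)} (∂_{(EuclideanSpace.single i 1 : Pt)} Φ))
          (z - t • EuclideanSpace.single i 1) =
      -c * 𝓕⁻ (fun k : Pt => ((|k i| ^ α : ℝ) : ℂ) * 𝓕 (Φ : Pt → ℂ) k) z := by
  obtain ⟨c, hc, H⟩ := integral_abs_rpow_mul_integral_exp (s := α - 1) (by linarith) (by linarith)
  have hpi := Real.pi_pos
  refine ⟨c * (4 * Real.pi ^ 2), by positivity, fun Φ i z hint => ?_⟩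
  set m : Pt := EuclideanSpace.single i 1 with hm
  set Ψ := ∂_{m} (∂_{m} Φ) with hΨ
  have hF : ∀ k, 𝓕 Ψ k = -((4 * Real.pi ^ 2 * (k i) ^ 2 : ℝ) : ℂ) * 𝓕 Φ k :=
    fourier_lineDeriv_lineDeriv Φ i
  set G : Pt → ℂ := fun k =>
    Complex.exp ((2 * Real.pi * inner ℝ k z : ℝ) * Complex.I) * 𝓕 Ψ k with hG
  have hmeas : Measurable (fun k : Pt => k i) := by fun_prop
  have hexp : Measurable (fun k : Pt =>
      Complex.exp ((2 * Real.pi * inner ℝ k z : ℝ) * Complex.I)) := by fun_prop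
  have hki : ∀ k : Pt, |k i| ≤ ‖k‖ := fun k => by
    simpa using PiLp.norm_apply_le k i
  have hGi : Integrable G := by
    refine (𝓕 Ψ).integrable.mono (hexp.aestronglyMeasurable.mul
      (𝓕 Ψ).continuous.aestronglyMeasurable) (ae_of_all _ fun k => ?_)
    simp only [hG, norm_mul, Complex.norm_exp_ofReal_mul_I, one_mul]; exact le_rfl
  have hpow : ∀ x : ℝ, |x| ^ (α - 1 - 1) * x ^ 2 = |x| ^ α := by
    intro x
    rcases eq_or_ne x 0 with rfl | hx
    · simp [Real.zero_rpow (show α ≠ 0 by linarith)]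
    · rw [← sq_abs, ← Real.rpow_two, ← Real.rpow_add (abs_pos.mpr hx)]
      congr 1; ring
  have hGk : ∀ k, ((|k i| ^ (α - 1 - 1) : ℝ) : ℂ) * G k = -((4 * Real.pi ^ 2 : ℝ) : ℂ) *
      (Complex.exp ((2 * Real.pi * inner ℝ k z : ℝ) * Complex.I) *
        (((|k i| ^ α : ℝ) : ℂ) * 𝓕 Φ k)) := by
    intro k
    rw [← hpow (k i)]
    simp only [hG, hF]
    push_cast; ring
  have hGi' : Integrable (fun k => ((|k i| ^ (α - 1 - 1) : ℝ) : ℂ) * G k) := by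
    simp only [hGk]
    refine Integrable.const_mul ?_ _
    have i0 := integrable_abs_rpow_mul_schwartz (by linarith) h2.le (𝓕 Φ) hmeas hki
    refine i0.mono (hexp.aestronglyMeasurable.mul i0.1) (ae_of_all _ fun k => ?_)
    rw [norm_mul, Complex.norm_exp_ofReal_mul_I, one_mul]
  have hΨt : ∀ t : ℝ, Ψ (z - t • m) =
      ∫ k : Pt, G k * Complex.exp (-(2 * Real.pi * (k i : ℂ) * t) * Complex.I) := by
    intro t
    have e : Ψ = 𝓕⁻ (𝓕 Ψ) := (FourierTransform.fourierInv_fourier_eq Ψ).symm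
    rw [show Ψ (z - t • m) = (𝓕⁻ (𝓕 Ψ)) (z - t • m) by rw [← e], SchwartzMap.fourierInv_coe,
      Real.fourierInv_eq']
    refine integral_congr_ae (ae_of_all _ fun k => ?_)
    simp only [hG, smul_eq_mul]
    have : inner ℝ k (z - t • m) = inner ℝ k z - t * k i := by
      rw [inner_sub_right, inner_smul_right, hm, EuclideanSpace.inner_single_right]; simp
    rw [this]
    conv_rhs => rw [mul_right_comm, ← Complex.exp_add]
    congr 2
    push_cast; ring
  simp only [hΨt] at hint ⊢
  have e1 : -(α - 1) = 1 - α := by ring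
  have := H (fun k => k i) G hmeas hGi hGi'
    (fun k hk => by simp only [hG, hF]; simp only [hk]; simp) (by rw [e1]; exact hint)
  rw [e1] at this
  rw [this, Real.fourierInv_eq']
  simp only [hGk, smul_eq_mul]
  rw [integral_const_mul]
  simp only [SchwartzMap.fourier_coe]
  push_cast; ring

/-- Conclusion and hypothesis have the same shape, so the lemma can be applied to its own output to
reach second derivatives. -/
theorem ofReal_deriv_line {g : ℝ → ℝ} {Ψ : 𝓢(Pt, ℂ)} {z m : Pt} {r : ℝ}
    (h : ∀ s, (g s : ℂ) = Ψ (z + (s - r) • m)) (s : ℝ) :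
    ((deriv g s : ℝ) : ℂ) = (∂_{m} Ψ) (z + (s - r) • m) := by
  have hγ : HasDerivAt (fun s : ℝ => z + (s - r) • m) m s := by
    simpa using (((hasDerivAt_id s).sub_const r).smul_const m).const_add z
  have hD : HasDerivAt (fun s => Ψ (z + (s - r) • m)) ((∂_{m} Ψ) (z + (s - r) • m)) s := by
    rw [SchwartzMap.lineDerivOp_apply_eq_fderiv]
    exact (Ψ.differentiableAt.hasFDerivAt).comp_hasDerivAt s hγ
  rw [← funext h] at hD
  have hre : HasDerivAt g (((∂_{m} Ψ) (z + (s - r) • m)).re) s := by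
    simpa [Function.comp_def] using Complex.reCLM.hasFDerivAt.comp_hasDerivAt s hD
  exact hre.ofReal_comp.unique hD ▸ by rw [hre.deriv]

theorem IsTest.line {Ω : Set Pt} {φ : Pt → ℝ} (hφ : IsTest Ω φ) {a b : ℝ} {i : Fin 2}
    (hΩ : ∀ z ∈ Ω, a < z i ∧ z i < b) (z : Pt) :
    ContDiff ℝ ∞ (fun s : ℝ => φ (z + (s - z i) • EuclideanSpace.single i 1)) ∧
    tsupport (fun s : ℝ => φ (z + (s - z i) • EuclideanSpace.single i 1)) ⊆ Ioo a b := by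
  constructor
  · exact hφ.1.comp (by fun_prop)
  · intro s hs
    have hcont : Continuous (fun s : ℝ => z + (s - z i) • (EuclideanSpace.single i 1 : Pt)) := by
      fun_prop
    have := hΩ _ (hφ.2.2 (tsupport_comp_subset_preimage φ hcont hs))
    simpa using this

/-- The Riesz derivative of a test function in a coordinate direction as a Fourier multiplier. -/
theorem riesz_line_eq_fourierInv {α : ℝ} (h1 : 1 < α) (h2 : α < 2) :
    ∃ c : ℝ, 0 < c ∧ ∀ (Ω : Set Pt) (φ : Pt → ℝ) (a b : ℝ) (i : Fin 2) (z : Pt), IsTest Ω φ →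
      (∀ w ∈ Ω, a < w i ∧ w i < b) → a < z i → z i < b →
      (((-1) / (2 * Real.cos (Real.pi * α / 2)) *
        (leftRL a α (fun s => φ (z + (s - z i) • EuclideanSpace.single i 1)) (z i) +
          rightRL b α (fun s => φ (z + (s - z i) • EuclideanSpace.single i 1)) (z i)) : ℝ) : ℂ) =
      -c * 𝓕⁻ (fun k : Pt => ((|k i| ^ α : ℝ) : ℂ) * 𝓕 (fun w => (φ w : ℂ)) k) z := by
  obtain ⟨c, hc, H⟩ := integral_abs_rpow_mul_lineDeriv h1 h2
  -- For `1 < α < 2` the cosine is negative, so the prefactor of the Riesz derivative is positive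
  -- and the operator has a negative symbol.
  have hcos : Real.cos (Real.pi * α / 2) < 0 := by
    have := Real.pi_pos
    apply Real.cos_neg_of_pi_div_two_lt_of_lt <;> nlinarith
  have hΓ := Real.Gamma_pos_of_pos (show 0 < 2 - α by linarith)
  have hC : 0 < (-1) / (2 * Real.cos (Real.pi * α / 2)) :=
    div_pos_of_neg_of_neg (by norm_num) (by linarith)
  refine ⟨(-1) / (2 * Real.cos (Real.pi * α / 2)) * ((Real.Gamma (2 - α))⁻¹ * c), by positivity,
    fun Ω φ a b i z hφ hΩ ha hb => ?_⟩
  set m : Pt := EuclideanSpace.single i 1 with hm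
  set f : ℝ → ℝ := fun s => φ (z + (s - z i) • m) with hf
  obtain ⟨hfs, hft⟩ := hφ.line hΩ z
  have hfc : HasCompactSupport f := HasCompactSupport.of_support_subset_isCompact isCompact_Icc
      ((subset_tsupport f).trans (hft.trans Ioo_subset_Icc_self))
  have d1 : ∀ s, (f s : ℂ) = hφ.toSchwartz (z + (s - z i) • m) := fun s => rfl
  have d3 := ofReal_deriv_line (ofReal_deriv_line d1)
  have hline : ∀ t : ℝ, ((deriv (deriv f) (z i - t) : ℝ) : ℂ) =
      (∂_{m} (∂_{m} hφ.toSchwartz)) (z - t • m) := by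
    intro t
    rw [d3]
    congr 1
    rw [sub_sub_cancel_left, neg_smul, sub_eq_add_neg]
  have hd : Continuous (deriv (deriv f)) :=
    ((contDiff_infty_iff_deriv.mp (contDiff_infty_iff_deriv.mp hfs).2).2).continuous
  have hint := (integrable_abs_rpow_mul_comp_sub (r := 1 - α) (by linarith) hd hfc.deriv.deriv
    (z i)).ofReal (𝕜 := ℂ)
  have hfun : (fun t : ℝ => ((|t| ^ (1 - α) * deriv (deriv f) (z i - t) : ℝ) : ℂ)) = fun t =>
      ((|t| ^ (1 - α) : ℝ) : ℂ) * (∂_{m} (∂_{m} hφ.toSchwartz)) (z - t • m) := by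
    funext t
    rw [Complex.ofReal_mul, hline]
  have hI := H hφ.toSchwartz i z (by rw [← hfun]; exact hint)
  rw [leftRL_add_rightRL h1 h2 hfs hft ⟨ha, hb⟩, Complex.ofReal_mul, Complex.ofReal_mul,
    ← integral_complex_ofReal, hfun, hI]
  push_cast
  have : (hφ.toSchwartz : Pt → ℂ) = fun w => (φ w : ℂ) := rfl
  rw [this]
  ring

/-! ### The rectangle, transforms of zero extensions, and the symbol -/

namespace Data

variable (D : Data)

theorem isOpen_Ω : IsOpen D.Ω := by
  have : D.Ω = {z : Pt | D.a < z 0} ∩ {z | z 0 < D.b} ∩ {z | D.c < z 1} ∩ {z | z 1 < D.d} := by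
    ext z; simp [Ω, and_assoc]
  rw [this]
  exact (((isOpen_lt (by fun_prop) (by fun_prop)).inter (isOpen_lt (by fun_prop) (by fun_prop))).inter
    (isOpen_lt (by fun_prop) (by fun_prop))).inter (isOpen_lt (by fun_prop) (by fun_prop))

theorem measurableSet_Ω : MeasurableSet D.Ω := D.isOpen_Ω.measurableSet

theorem isBounded_Ω : Bornology.IsBounded D.Ω := by
  rw [isBounded_iff_forall_norm_le]
  refine ⟨Real.sqrt ((|D.a| + |D.b|) ^ 2 + (|D.c| + |D.d|) ^ 2), fun z hz => ?_⟩
  obtain ⟨h1, h2, h3, h4⟩ := hz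
  rw [EuclideanSpace.norm_eq, Fin.sum_univ_two]
  apply Real.sqrt_le_sqrt
  simp only [Real.norm_eq_abs]
  have e1 : |z 0| ≤ |D.a| + |D.b| := by
    rw [abs_le]; constructor <;> cases abs_cases D.a <;> cases abs_cases D.b <;> linarith
  have e2 : |z 1| ≤ |D.c| + |D.d| := by
    rw [abs_le]; constructor <;> cases abs_cases D.c <;> cases abs_cases D.d <;> linarith
  gcongr

theorem volume_Ω_lt_top : volume D.Ω < ⊤ := D.isBounded_Ω.measure_lt_top

instance : IsFiniteMeasure (volume.restrict D.Ω) := ⟨by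
  rw [Measure.restrict_apply_univ]; exact D.volume_Ω_lt_top⟩

/-- The Fourier transform of the extension by zero of a function on `Ω`. -/
noncomputable def fhat (v : Pt → ℝ) : Pt → ℂ :=
  𝓕 (fun z : Pt => ((D.Ω.indicator v z : ℝ) : ℂ))

variable {D}

theorem indicator_of_isTest {φ : Pt → ℝ} (hφ : IsTest D.Ω φ) : D.Ω.indicator φ = φ :=
  indicator_eq_self.mpr ((subset_tsupport φ).trans hφ.2.2)

theorem fhat_of_isTest {φ : Pt → ℝ} (hφ : IsTest D.Ω φ) :
    D.fhat φ = 𝓕 (fun z => (φ z : ℂ)) := by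
  rw [fhat, indicator_of_isTest hφ]

theorem fhat_eq_schwartz {φ : Pt → ℝ} (hφ : IsTest D.Ω φ) :
    D.fhat φ = (𝓕 hφ.toSchwartz : 𝓢(Pt, ℂ)) := by
  rw [fhat_of_isTest hφ, SchwartzMap.fourier_coe]; rfl

theorem integrable_ext {v : Pt → ℝ} (hv : MemL2 D.Ω v) :
    Integrable (fun z : Pt => ((D.Ω.indicator v z : ℝ) : ℂ)) :=
  ((integrable_indicator_iff D.measurableSet_Ω).mpr (hv.integrable (by norm_num))).ofReal

theorem continuous_fhat {v : Pt → ℝ} (hv : MemL2 D.Ω v) : Continuous (D.fhat v) :=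
  VectorFourier.fourierIntegral_continuous Real.continuous_fourierChar
    (by exact continuous_inner) (integrable_ext hv)

theorem norm_fhat_le (v : Pt → ℝ) (k : Pt) :
    ‖D.fhat v k‖ ≤ ∫ z in D.Ω, |v z| := by
  refine (VectorFourier.norm_fourierIntegral_le_integral_norm _ _ _ _ k).trans (le_of_eq ?_)
  rw [← integral_indicator D.measurableSet_Ω]
  congr 1; funext z
  by_cases h : z ∈ D.Ω <;> simp [h]

theorem fhat_sub {v w : Pt → ℝ} (hv : MemL2 D.Ω v) (hw : MemL2 D.Ω w) :
    D.fhat (fun z => v z - w z) = fun k => D.fhat v k - D.fhat w k := by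
  funext k
  simp only [fhat, Real.fourier_eq]
  rw [← integral_sub]
  · congr 1; funext z
    by_cases h : z ∈ D.Ω <;> simp [h, smul_sub]
  · exact (Real.fourierIntegral_convergent_iff k).2 (integrable_ext hv)
  · exact (Real.fourierIntegral_convergent_iff k).2 (integrable_ext hw)

theorem memL2_of_isTest {φ : Pt → ℝ} (hφ : IsTest D.Ω φ) : MemL2 D.Ω φ :=
  (hφ.1.continuous.memLp_of_hasCompactSupport hφ.2.1).restrict _

variable (D) in
/-- `M` is the symbol of `-(κ₁ ∂^α/∂|x|^α + κ₂ ∂^α/∂|y|^α)`, and it is comparable to `|k|^α`. -/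
structure IsSymbol (M : Pt → ℝ) : Prop where
  continuous : Continuous M
  lower : ∃ c : ℝ, 0 < c ∧ ∀ k, c * ‖k‖ ^ D.α ≤ M k
  upper : ∃ C : ℝ, 0 < C ∧ ∀ k, M k ≤ C * ‖k‖ ^ D.α
  riesz_eq : ∀ φ, IsTest D.Ω φ → ∀ z ∈ D.Ω,
    ((D.riesz φ z : ℝ) : ℂ) = -𝓕⁻ (fun k => (M k : ℂ) * D.fhat φ k) z

theorem norm_rpow_le {α : ℝ} (h0 : 0 ≤ α) (k : Pt) :
    ‖k‖ ^ α ≤ 2 ^ α * (|k 0| ^ α + |k 1| ^ α) := by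
  have h : ‖k‖ ≤ |k 0| + |k 1| := by
    rw [EuclideanSpace.norm_eq, Fin.sum_univ_two]
    refine Real.sqrt_le_iff.mpr ⟨by positivity, ?_⟩
    simp only [Real.norm_eq_abs]
    nlinarith [abs_nonneg (k 0), abs_nonneg (k 1)]
  have h0' := abs_nonneg (k 0)
  have h1' := abs_nonneg (k 1)
  have p0 : 0 ≤ |k 0| ^ α := by positivity
  have p1 : 0 ≤ |k 1| ^ α := by positivity
  have p2 : (0 : ℝ) ≤ 2 ^ α := by positivity
  rcases le_total (|k 0|) (|k 1|) with h' | h'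
  · calc ‖k‖ ^ α ≤ (2 * |k 1|) ^ α := Real.rpow_le_rpow (norm_nonneg _) (by linarith) h0
      _ = 2 ^ α * |k 1| ^ α := Real.mul_rpow (by norm_num) h1'
      _ ≤ _ := by gcongr; linarith
  · calc ‖k‖ ^ α ≤ (2 * |k 0|) ^ α := Real.rpow_le_rpow (norm_nonneg _) (by linarith) h0
      _ = 2 ^ α * |k 0| ^ α := Real.mul_rpow (by norm_num) h0'
      _ ≤ _ := by gcongr; linarith

theorem abs_apply_le_norm (k : Pt) (i : Fin 2) : |k i| ≤ ‖k‖ := by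
  simpa using PiLp.norm_apply_le k i

-- The multiplier constant depends on `α` alone, so one `c` serves both directions and `M(k) = c (κ₁
-- |k 0|^α + κ₂ |k 1|^α)`, which is comparable to `‖k‖^α` because both `κ` are positive.
variable (D) in
theorem exists_isSymbol : ∃ M, D.IsSymbol M := by
  obtain ⟨c, hc, H⟩ := riesz_line_eq_fourierInv D.one_lt_α D.α_lt_two
  have hα0 : 0 < D.α := by linarith [D.one_lt_α]
  have h1 := D.κ₁_pos
  have h2 := D.κ₂_pos
  refine ⟨fun k => c * (D.κ₁ * |k 0| ^ D.α + D.κ₂ * |k 1| ^ D.α), ?_, ?_, ?_, ?_⟩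
  · have : ∀ i : Fin 2, Continuous fun k : Pt => |k i| ^ D.α := fun i =>
      Continuous.rpow_const (by fun_prop) fun _ => Or.inr hα0.le
    exact continuous_const.mul ((continuous_const.mul (this 0)).add (continuous_const.mul (this 1)))
  · have hm : 0 < min D.κ₁ D.κ₂ := lt_min h1 h2
    refine ⟨c * min D.κ₁ D.κ₂ * (2 ^ D.α)⁻¹, by positivity, fun k => ?_⟩
    have hk := norm_rpow_le hα0.le k
    rw [mul_assoc, mul_assoc]
    refine mul_le_mul_of_nonneg_left ?_ hc.le
    calc min D.κ₁ D.κ₂ * ((2 ^ D.α)⁻¹ * ‖k‖ ^ D.α)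
        ≤ min D.κ₁ D.κ₂ * (|k 0| ^ D.α + |k 1| ^ D.α) := by
          refine mul_le_mul_of_nonneg_left ?_ hm.le
          rw [inv_mul_le_iff₀ (by positivity)]; exact hk
      _ ≤ _ := by
          rw [mul_add]
          gcongr
          · exact min_le_left _ _
          · exact min_le_right _ _
  · refine ⟨c * (D.κ₁ + D.κ₂), by positivity, fun k => ?_⟩
    rw [mul_assoc, add_mul]
    refine mul_le_mul_of_nonneg_left ?_ hc.le
    gcongr
    · exact abs_apply_le_norm k 0
    · exact abs_apply_le_norm k 1
  · intro φ hφ z hz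
    have hx := H D.Ω φ D.a D.b 0 z hφ (fun w hw => ⟨hw.1, hw.2.1⟩) hz.1 hz.2.1
    have hy := H D.Ω φ D.c D.d 1 z hφ (fun w hw => ⟨hw.2.2.1, hw.2.2.2⟩) hz.2.2.1 hz.2.2.2
    have ex : ∀ s : ℝ, z + (s - z 0) • EuclideanSpace.single 0 1 = !₂[s, z 1] := by
      intro s; ext i; fin_cases i <;> simp
    have ey : ∀ s : ℝ, z + (s - z 1) • EuclideanSpace.single 1 1 = !₂[z 0, s] := by
      intro s; ext i; fin_cases i <;> simp
    simp only [ex] at hx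
    simp only [ey] at hy
    rw [riesz, Complex.ofReal_add, Complex.ofReal_mul, Complex.ofReal_mul]
    have hx' : ((rieszX D.a D.b D.α φ z : ℝ) : ℂ) = _ := hx
    have hy' : ((rieszY D.c D.d D.α φ z : ℝ) : ℂ) = _ := hy
    rw [hx', hy', ← fhat_of_isTest hφ]
    have hi : ∀ i : Fin 2, Integrable (fun k : Pt => ((|k i| ^ D.α : ℝ) : ℂ) * D.fhat φ k) := by
      intro i
      rw [fhat_eq_schwartz hφ]
      exact integrable_abs_rpow_mul_schwartz hα0.le D.α_lt_two.le _ (by fun_prop)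
        fun k => abs_apply_le_norm k i
    have hi' : ∀ i : Fin 2, Integrable (fun k : Pt =>
        Complex.exp ((2 * Real.pi * inner ℝ k z : ℝ) * Complex.I) *
          (((|k i| ^ D.α : ℝ) : ℂ) * D.fhat φ k)) := by
      intro i
      refine (hi i).mono (AEStronglyMeasurable.mul
        (Continuous.aestronglyMeasurable (by fun_prop)) (hi i).1) (ae_of_all _ fun k => ?_)
      rw [norm_mul, Complex.norm_exp_ofReal_mul_I, one_mul]
    simp only [Real.fourierInv_eq', smul_eq_mul]
    have e : ∀ k : Pt, Complex.exp ((2 * Real.pi * inner ℝ k z : ℝ) * Complex.I) *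
        (((c * (D.κ₁ * |k 0| ^ D.α + D.κ₂ * |k 1| ^ D.α) : ℝ) : ℂ) * D.fhat φ k) =
        (c * D.κ₁) * (Complex.exp ((2 * Real.pi * inner ℝ k z : ℝ) * Complex.I) *
          (((|k 0| ^ D.α : ℝ) : ℂ) * D.fhat φ k)) +
        (c * D.κ₂) * (Complex.exp ((2 * Real.pi * inner ℝ k z : ℝ) * Complex.I) *
          (((|k 1| ^ D.α : ℝ) : ℂ) * D.fhat φ k)) := by
      intro k; push_cast; ring
    simp only [e]
    rw [integral_add ((hi' 0).const_mul _) ((hi' 1).const_mul _), integral_const_mul,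
      integral_const_mul]
    ring

end Data

/-! ### The energy form, `H_0^{α/2}(Ω)` and the symmetry of weak solutions -/

/-- Real `L²` pairings are continuous in the second argument. -/
theorem tendsto_integral_inner {X E : Type*} [MeasurableSpace X] {μ : Measure X}
    [NormedAddCommGroup E] [InnerProductSpace ℝ E] {f w : X → E} {φ : ℕ → X → E}
    (hf : MemLp f 2 μ) (hw : MemLp w 2 μ) (hφ : ∀ n, MemLp (φ n) 2 μ)
    (h : Tendsto (fun n => eLpNorm (fun x => w x - φ n x) 2 μ) atTop (𝓝 0)) :
    Tendsto (fun n => ∫ x, inner ℝ (f x) (φ n x) ∂μ) atTop (𝓝 (∫ x, inner ℝ (f x) (w x) ∂μ)) := by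
  have key : ∀ g (hg : MemLp g 2 μ), ∫ x, inner ℝ (f x) (g x) ∂μ =
      inner ℝ (hf.toLp f) (hg.toLp g) := by
    intro g hg
    rw [L2.inner_def]
    refine integral_congr_ae ?_
    filter_upwards [hf.coeFn_toLp, hg.coeFn_toLp] with x h1 h2
    rw [h1, h2]
  simp only [key w hw, fun n => key (φ n) (hφ n)]
  refine Tendsto.inner tendsto_const_nhds ?_
  rw [Lp.tendsto_Lp_iff_tendsto_eLpNorm'' _ hφ _ hw]
  refine h.congr fun n => ?_
  rw [← eLpNorm_neg]
  congr 1
  funext x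
  simp

theorem ip_symm (Ω : Set Pt) (f g : Pt → ℝ) : ip Ω f g = ip Ω g f := by
  simp only [ip, mul_comm]

theorem ip_const_mul_left (Ω : Set Pt) (f g : Pt → ℝ) (r : ℝ) :
    ip Ω (fun z => r * f z) g = r * ip Ω f g := by
  rw [ip, ip, ← integral_const_mul]
  congr 1; funext z; ring

theorem ip_const_mul_right (Ω : Set Pt) (f g : Pt → ℝ) (r : ℝ) :
    ip Ω f (fun z => r * g z) = r * ip Ω f g := by
  rw [ip_symm, ip_const_mul_left, ip_symm]

namespace Data

variable {D : Data} {M : Pt → ℝ}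

variable (D M) in
/-- The square root of the energy density: `√M 𝓕[ṽ]`. -/
noncomputable def energyDensity (v : Pt → ℝ) (k : Pt) : ℂ := (Real.sqrt (M k) : ℂ) * D.fhat v k

variable (D M) in
/-- The bilinear form of the operator with symbol `M`. -/
noncomputable def energy (v w : Pt → ℝ) : ℝ :=
  ∫ k, inner ℝ (D.energyDensity M v k) (D.energyDensity M w k)

theorem energy_comm (v w : Pt → ℝ) : D.energy M v w = D.energy M w v := by
  simp only [energy, real_inner_comm]

theorem IsSymbol.nonneg (hM : D.IsSymbol M) (k : Pt) : 0 ≤ M k := by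
  obtain ⟨c, hc, h⟩ := hM.lower
  exact le_trans (by positivity) (h k)

theorem IsSymbol.integrable_mul_fhat (hM : D.IsSymbol M) {φ : Pt → ℝ} (hφ : IsTest D.Ω φ) :
    Integrable (fun k => (M k : ℂ) * D.fhat φ k) := by
  obtain ⟨C, hC, h⟩ := hM.upper
  have h1 := D.one_lt_α
  have i := integrable_abs_rpow_mul_schwartz (α := D.α) (by linarith) D.α_lt_two.le
    (𝓕 hφ.toSchwartz) (ℓ := fun k => ‖k‖) (by fun_prop) (fun k => by simp)
  rw [fhat_eq_schwartz hφ]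
  refine (i.const_mul (C : ℂ)).mono ?_ (ae_of_all _ fun k => ?_)
  · exact ((Complex.continuous_ofReal.comp hM.continuous).mul
      (𝓕 hφ.toSchwartz : 𝓢(Pt, ℂ)).continuous).aestronglyMeasurable
  · have := h k
    simp only [norm_mul, Complex.norm_real, Real.norm_eq_abs, abs_norm]
    rw [abs_of_nonneg (hM.nonneg k), abs_of_pos hC, ← mul_assoc,
      abs_of_nonneg (show 0 ≤ ‖k‖ ^ D.α by positivity)]
    gcongr

theorem continuous_energyDensity (hM : D.IsSymbol M) {v : Pt → ℝ} (hv : MemL2 D.Ω v) :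
    Continuous (D.energyDensity M v) :=
  (Complex.continuous_ofReal.comp hM.continuous.sqrt).mul (continuous_fhat hv)

/-- Moving both square roots onto `w` is useful when `w` is a test function: then `M ŵ` is
integrable while `v̂` is merely bounded. -/
theorem inner_energyDensity (hM : D.IsSymbol M) (v w : Pt → ℝ) (k : Pt) :
    inner ℝ (D.energyDensity M v k) (D.energyDensity M w k) =
      ((inner ℂ (D.fhat v k) ((M k : ℂ) * D.fhat w k) : ℂ)).re := by
  have h := Real.mul_self_sqrt (hM.nonneg k)
  rw [Complex.inner]
  simp only [energyDensity, map_mul, Complex.conj_ofReal, RCLike.inner_apply]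
  congr 1
  rw [show (M k : ℂ) = (Real.sqrt (M k) : ℂ) * (Real.sqrt (M k) : ℂ) by
    rw [← Complex.ofReal_mul, h]]
  ring

theorem integrable_inner_fhat (hM : D.IsSymbol M) {v φ : Pt → ℝ} (hv : MemL2 D.Ω v)
    (hφ : IsTest D.Ω φ) :
    Integrable (fun k => (inner ℂ (D.fhat v k) ((M k : ℂ) * D.fhat φ k) : ℂ)) := by
  refine ((hM.integrable_mul_fhat hφ).norm.const_mul (∫ z in D.Ω, |v z|)).mono' ?_
    (ae_of_all _ fun k => ?_)
  · exact (continuous_fhat hv).aestronglyMeasurable.inner (hM.integrable_mul_fhat hφ).1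
  · refine (norm_inner_le_norm _ _).trans ?_
    gcongr
    exact norm_fhat_le v k

theorem memLp_energyDensity_of_isTest (hM : D.IsSymbol M) {φ : Pt → ℝ} (hφ : IsTest D.Ω φ) :
    MemLp (D.energyDensity M φ) 2 := by
  have hL := memL2_of_isTest hφ
  rw [memLp_two_iff_integrable_sq_norm (continuous_energyDensity hM hL).aestronglyMeasurable]
  refine (integrable_inner_fhat hM hL hφ).re.congr (ae_of_all _ fun k => ?_)
  simp only
  rw [← real_inner_self_eq_norm_sq, inner_energyDensity hM]
  rfl

/-- On `Ω` the Riesz expression is the inverse transform of an integrable function, hence continuous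
and bounded. This supplies measurability and square integrability there without analysing the
Riemann–Liouville integrals. -/
theorem riesz_eqOn (hM : D.IsSymbol M) {φ : Pt → ℝ} (hφ : IsTest D.Ω φ) :
    ∃ F : Pt → ℝ, Continuous F ∧ (∃ B, ∀ z, ‖F z‖ ≤ B) ∧ EqOn (D.riesz φ) F D.Ω := by
  refine ⟨fun z => (-𝓕⁻ (fun k => (M k : ℂ) * D.fhat φ k) z).re, ?_, ?_, fun z hz => ?_⟩
  · refine Complex.continuous_re.comp (Continuous.neg ?_)
    exact VectorFourier.fourierIntegral_continuous Real.continuous_fourierChar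
      (by
        change Continuous fun p : Pt × Pt => -(inner ℝ p.1 p.2)
        fun_prop) (hM.integrable_mul_fhat hφ)
  · refine ⟨∫ k, ‖(M k : ℂ) * D.fhat φ k‖, fun z => ?_⟩
    refine (Complex.abs_re_le_norm _).trans ?_
    rw [norm_neg]
    exact VectorFourier.norm_fourierIntegral_le_integral_norm _ _ _ _ z
  · simp only
    rw [← hM.riesz_eq φ hφ z hz, Complex.ofReal_re]

theorem memL2_riesz (hM : D.IsSymbol M) {φ : Pt → ℝ} (hφ : IsTest D.Ω φ) :
    MemL2 D.Ω (D.riesz φ) := by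
  obtain ⟨F, hF, ⟨B, hB⟩, h⟩ := riesz_eqOn hM hφ
  have : MemL2 D.Ω F := MemLp.of_bound hF.aestronglyMeasurable B (ae_of_all _ hB)
  refine MemLp.ae_eq ?_ this
  filter_upwards [ae_restrict_mem D.measurableSet_Ω] with z hz
  exact (h hz).symm

/-- The Riesz operator in weak form. -/
theorem ip_riesz (hM : D.IsSymbol M) {v φ : Pt → ℝ} (hv : MemL2 D.Ω v) (hφ : IsTest D.Ω φ) :
    ip D.Ω v (D.riesz φ) = -D.energy M v φ := by
  -- The transform is moved from one factor to the other by Fubini. This asks for two integrable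
  -- functions: the extension of `v` is integrable because `Ω` is bounded, and `M φ̂` decays
  -- rapidly.
  have h1 := VectorFourier.integral_sesq_fourierIntegral_eq_neg_flip (innerSL ℂ)
    Real.continuous_fourierChar (L := innerₗ Pt) (by exact continuous_inner)
    (integrable_ext hv) (hM.integrable_mul_fhat hφ)
  have h2 : ∫ k, (inner ℂ (D.fhat v k) ((M k : ℂ) * D.fhat φ k) : ℂ) =
      ∫ z, (inner ℂ ((D.Ω.indicator v z : ℝ) : ℂ)
        (𝓕⁻ (fun k => (M k : ℂ) * D.fhat φ k) z) : ℂ) := by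
    rw [flip_innerₗ] at h1
    exact h1
  have h3 : ((ip D.Ω v (D.riesz φ) : ℝ) : ℂ) =
      -∫ z, (inner ℂ ((D.Ω.indicator v z : ℝ) : ℂ)
        (𝓕⁻ (fun k => (M k : ℂ) * D.fhat φ k) z) : ℂ) := by
    rw [ip, ← integral_indicator D.measurableSet_Ω, ← integral_complex_ofReal, ← integral_neg]
    refine integral_congr_ae (ae_of_all _ fun z => ?_)
    by_cases h : z ∈ D.Ω
    · simp only [indicator_of_mem h, Complex.ofReal_mul, hM.riesz_eq φ hφ z h,
        RCLike.inner_apply, Complex.conj_ofReal]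
      ring
    · simp [h]
  rw [← h2] at h3
  have h4 := congrArg Complex.re h3
  rw [Complex.ofReal_re, Complex.neg_re] at h4
  rw [h4, energy]
  congr 1
  simp only [inner_energyDensity hM]
  exact (integral_re (integrable_inner_fhat hM hv hφ)).symm

theorem energyDensity_sub {v w : Pt → ℝ} (hv : MemL2 D.Ω v) (hw : MemL2 D.Ω w) :
    D.energyDensity M (fun z => v z - w z) =
      fun k => D.energyDensity M v k - D.energyDensity M w k := by
  funext k
  simp only [energyDensity, fhat_sub hv hw]; ring

theorem sobolevENorm_eq (v : Pt → ℝ) : sobolevENorm D.Ω (D.α / 2) v =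
    (eLpNorm v 2 (volume.restrict D.Ω) ^ 2 + eLpNorm (fun k : Pt =>
      ((‖k‖ ^ (D.α / 2) : ℝ) : ℂ) * D.fhat v k) 2 volume ^ 2) ^ (1 / 2 : ℝ) := rfl

theorem _root_.ENNReal.le_rpow_half_sq_add_sq (x y : ENNReal) :
    x ≤ (x ^ 2 + y ^ 2) ^ (1 / 2 : ℝ) := by
  calc x = (x ^ 2) ^ (1 / 2 : ℝ) := by
        rw [← ENNReal.rpow_natCast, ← ENNReal.rpow_mul]; norm_num
    _ ≤ _ := ENNReal.rpow_le_rpow le_self_add (by norm_num)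

theorem _root_.ENNReal.rpow_half_sq_add_sq_le (x y : ENNReal) :
    (x ^ 2 + y ^ 2) ^ (1 / 2 : ℝ) ≤ x + y := by
  calc _ ≤ ((x + y) ^ 2) ^ (1 / 2 : ℝ) := by
        refine ENNReal.rpow_le_rpow ?_ (by norm_num)
        rw [add_sq]
        gcongr
        exact le_self_add
    _ = _ := by rw [← ENNReal.rpow_natCast, ← ENNReal.rpow_mul]; norm_num

theorem norm_energyDensity (v : Pt → ℝ) (k : Pt) :
    ‖D.energyDensity M v k‖ = Real.sqrt (M k) * ‖D.fhat v k‖ := by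
  rw [energyDensity, norm_mul, Complex.norm_real, Real.norm_eq_abs, abs_of_nonneg (Real.sqrt_nonneg _)]

theorem norm_rpow_half_mul_fhat (v : Pt → ℝ) (k : Pt) :
    ‖((‖k‖ ^ (D.α / 2) : ℝ) : ℂ) * D.fhat v k‖ = Real.sqrt (‖k‖ ^ D.α) * ‖D.fhat v k‖ := by
  rw [norm_mul, Complex.norm_real, Real.norm_eq_abs, abs_of_nonneg (by positivity),
    Real.sqrt_eq_rpow, ← Real.rpow_mul (norm_nonneg _)]
  congr 2; ring

/-- `H_0^{α/2}(Ω)` in terms of the energy. -/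
theorem memH0_iff (hM : D.IsSymbol M) {v : Pt → ℝ} : MemH0 D.Ω (D.α / 2) v ↔
    MemL2 D.Ω v ∧ ∃ φ : ℕ → Pt → ℝ, (∀ n, IsTest D.Ω (φ n)) ∧
      Tendsto (fun n => eLpNorm (fun z => v z - φ n z) 2 (volume.restrict D.Ω)) atTop (𝓝 0) ∧
      Tendsto (fun n => eLpNorm (D.energyDensity M fun z => v z - φ n z) 2 volume)
        atTop (𝓝 0) := by
  obtain ⟨c, hc, hlow⟩ := hM.lower
  obtain ⟨C, hC, hup⟩ := hM.upper
  refine and_congr_right fun hv => exists_congr fun φ => and_congr_right fun hφ => ?_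
  constructor
  · intro h
    simp only [sobolevENorm_eq] at h
    have hA := tendsto_of_tendsto_of_tendsto_of_le_of_le tendsto_const_nhds h
      (fun n => zero_le) fun n => ENNReal.le_rpow_half_sq_add_sq _ _
    refine ⟨hA, ?_⟩
    have hB := tendsto_of_tendsto_of_tendsto_of_le_of_le tendsto_const_nhds h
      (fun n => zero_le) fun n => (ENNReal.le_rpow_half_sq_add_sq (eLpNorm (fun k : Pt =>
        ((‖k‖ ^ (D.α / 2) : ℝ) : ℂ) * D.fhat (fun z => v z - φ n z) k) 2 volume)
        (eLpNorm (fun z => v z - φ n z) 2 (volume.restrict D.Ω))).trans (by rw [add_comm])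
    -- The upper bound `M ≤ C ‖k‖^α` costs a factor `√C` on densities; the converse below uses the
    -- lower bound and `√(1/c)`.
    have hB' := ENNReal.Tendsto.const_mul (a := ENNReal.ofReal (Real.sqrt C)) hB
      (Or.inr ENNReal.ofReal_ne_top)
    rw [mul_zero] at hB'
    refine tendsto_of_tendsto_of_tendsto_of_le_of_le tendsto_const_nhds hB'
      (fun n => zero_le) fun n => ?_
    refine eLpNorm_le_mul_eLpNorm_of_ae_le_mul (ae_of_all _ fun k => ?_) 2
    rw [norm_energyDensity, norm_rpow_half_mul_fhat, ← mul_assoc, ← Real.sqrt_mul hC.le]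
    gcongr
    exact hup k
  · rintro ⟨hA, hB⟩
    have hB' := ENNReal.Tendsto.const_mul (a := ENNReal.ofReal (Real.sqrt c⁻¹)) hB
      (Or.inr ENNReal.ofReal_ne_top)
    have := hA.add hB'
    rw [mul_zero, add_zero] at this
    refine tendsto_of_tendsto_of_tendsto_of_le_of_le tendsto_const_nhds this
      (fun n => zero_le) fun n => ?_
    rw [sobolevENorm_eq]
    refine (ENNReal.rpow_half_sq_add_sq_le _ _).trans ?_
    gcongr
    refine eLpNorm_le_mul_eLpNorm_of_ae_le_mul (ae_of_all _ fun k => ?_) 2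
    rw [norm_energyDensity, norm_rpow_half_mul_fhat, ← mul_assoc, ← Real.sqrt_mul (by positivity)]
    gcongr
    rw [← div_eq_inv_mul, le_div_iff₀ hc, mul_comm]
    exact hlow k

/-- Some approximant has an error of finite energy, and the approximant itself has finite energy. -/
theorem memLp_energyDensity (hM : D.IsSymbol M) {v : Pt → ℝ} (hv : MemH0 D.Ω (D.α / 2) v) :
    MemLp (D.energyDensity M v) 2 := by
  obtain ⟨hL, φ, hφ, -, hB⟩ := (memH0_iff hM).mp hv
  obtain ⟨n, hn⟩ := (hB.eventually_lt_const ENNReal.zero_lt_top).exists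
  have hφL := memL2_of_isTest (hφ n)
  have h1 : MemLp (D.energyDensity M fun z => v z - φ n z) 2 :=
    ⟨(continuous_energyDensity hM (hL.sub hφL)).aestronglyMeasurable, hn⟩
  convert h1.add (memLp_energyDensity_of_isTest hM (hφ n)) using 1
  rw [energyDensity_sub hL hφL]
  funext k
  simp

/-- The energy identity: a solution may be tested with any element of `H_0^{α/2}(Ω)`. -/
theorem IsSolution.energy_eq (hM : D.IsSymbol M) {σ : ℝ} {f v w : Pt → ℝ}
    (hv : D.IsSolution σ f v) (hf : MemL2 D.Ω f) (hw : MemH0 D.Ω (D.α / 2) w) :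
    -σ * D.energy M v w = ip D.Ω f w := by
  obtain ⟨hL, φ, hφ, hA, hB⟩ := (memH0_iff hM).mp hw
  have t1 : Tendsto (fun n => ip D.Ω f (φ n)) atTop (𝓝 (ip D.Ω f w)) := by
    have := tendsto_integral_inner hf hL (fun n => memL2_of_isTest (hφ n)) hA
    simpa only [RCLike.inner_apply, conj_trivial, mul_comm, ip] using this
  have t2 : Tendsto (fun n => D.energy M v (φ n)) atTop (𝓝 (D.energy M v w)) := by
    refine tendsto_integral_inner (memLp_energyDensity hM hv.1) (memLp_energyDensity hM hw)
      (fun n => memLp_energyDensity_of_isTest hM (hφ n)) ?_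
    simpa only [energyDensity_sub hL (memL2_of_isTest (hφ _))] using hB
  refine tendsto_nhds_unique (t2.const_mul (-σ)) (t1.congr fun n => ?_)
  rw [← hv.2 _ (hφ n), ip_const_mul_right, ip_riesz hM hv.1.1 (hφ n)]
  ring

/-- The solution operator is symmetric. -/
theorem IsSolution.ip_comm {σ : ℝ} {f g v w : Pt → ℝ} (hv : D.IsSolution σ f v)
    (hw : D.IsSolution σ g w) (hf : MemL2 D.Ω f) (hg : MemL2 D.Ω g) :
    ip D.Ω f w = ip D.Ω g v := by
  obtain ⟨M, hM⟩ := D.exists_isSymbol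
  rw [← hv.energy_eq hM hf hw.1, ← hw.energy_eq hM hg hv.1, energy_comm]

end Data

/-! ### Poincaré inequality and existence of weak solutions -/

theorem normL2_sq {Ω : Set Pt} {f : Pt → ℝ} (hf : MemL2 Ω f) : normL2 Ω f ^ 2 = ip Ω f f := by
  rw [normL2, ← Lp.norm_toLp f hf, ← real_inner_self_eq_norm_sq, L2.inner_def, ip]
  refine integral_congr_ae ?_
  filter_upwards [hf.coeFn_toLp] with z hz
  rw [hz]; simp [sq]

theorem MemL2.integrable_mul {Ω : Set Pt} {f g : Pt → ℝ} (hf : MemL2 Ω f) (hg : MemL2 Ω g) :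
    Integrable (fun z => f z * g z) (volume.restrict Ω) :=
  MemLp.integrable_mul hf hg

theorem IsTest.add {Ω : Set Pt} {φ ψ : Pt → ℝ} (hφ : IsTest Ω φ) (hψ : IsTest Ω ψ) :
    IsTest Ω (fun z => φ z + ψ z) :=
  ⟨hφ.1.add hψ.1, hφ.2.1.add hψ.2.1, (tsupport_add φ ψ).trans (union_subset hφ.2.2 hψ.2.2)⟩

theorem IsTest.const_mul {Ω : Set Pt} {φ : Pt → ℝ} (hφ : IsTest Ω φ) (r : ℝ) :
    IsTest Ω (fun z => r * φ z) :=
  ⟨contDiff_const.mul hφ.1, hφ.2.1.mul_left,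
    (tsupport_mul_subset_right (f := fun _ => r) (g := φ)).trans hφ.2.2⟩

theorem isTest_zero (Ω : Set Pt) : IsTest Ω (fun _ => 0) :=
  ⟨contDiff_const, HasCompactSupport.zero, by simp [tsupport]⟩

/-- The Lax--Milgram theorem on a closed subspace of a product of Hilbert spaces, for the inner
product of the second components. -/
theorem exists_inner_snd_eq_inner_fst {H₁ H₂ : Type*} [NormedAddCommGroup H₁]
    [InnerProductSpace ℝ H₁] [CompleteSpace H₁] [NormedAddCommGroup H₂] [InnerProductSpace ℝ H₂]
    [CompleteSpace H₂] {S : Submodule ℝ (WithLp 2 (H₁ × H₂))}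
    (hS : IsClosed (S : Set (WithLp 2 (H₁ × H₂)))) {C : ℝ} (hC : 0 < C)
    (h : ∀ X ∈ S, ‖X‖ ^ 2 ≤ C * ‖X.snd‖ ^ 2) (f : H₁) :
    ∃ X ∈ S, ∀ Y ∈ S, inner ℝ X.snd Y.snd = inner ℝ f Y.fst := by
  have : CompleteSpace S := hS.completeSpace_coe
  let P₁ : S →L[ℝ] H₁ := (WithLp.fstL 2 ℝ H₁ H₂).comp S.subtypeL
  let P₂ : S →L[ℝ] H₂ := (WithLp.sndL 2 ℝ H₁ H₂).comp S.subtypeL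
  let B : S →L[ℝ] S →L[ℝ] ℝ := (innerSL ℝ).bilinearComp P₂ P₂
  have hBapp : ∀ X Y : S, B X Y = inner ℝ (X : WithLp 2 (H₁ × H₂)).snd
    (Y : WithLp 2 (H₁ × H₂)).snd := fun X Y => rfl
  have hB : IsCoercive B := by
    refine ⟨C⁻¹, by positivity, fun X => ?_⟩
    rw [hBapp, real_inner_self_eq_norm_sq, mul_assoc, ← sq, inv_mul_le_iff₀ hC]
    exact h X X.2
  let l : S →L[ℝ] ℝ := (innerSL ℝ f).comp P₁
  let X : S := hB.continuousLinearEquivOfBilin.symm ((InnerProductSpace.toDual ℝ S).symm l)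
  refine ⟨X, X.2, fun Y hY => ?_⟩
  have hX : B X ⟨Y, hY⟩ = l ⟨Y, hY⟩ := by
    rw [← hB.continuousLinearEquivOfBilin_apply]
    simp only [X, ContinuousLinearEquiv.apply_symm_apply]
    rw [InnerProductSpace.toDual_symm_apply]
  exact hX

namespace Data

variable {D : Data} {M : Pt → ℝ}

/-- Cauchy–Schwarz, by expanding `∫ (|v| - S/V)² ≥ 0`. Enlarging the area by `1` makes `V` visibly
positive. -/
theorem sq_integral_abs_le {v : Pt → ℝ} (hv : MemL2 D.Ω v) :
    (∫ z in D.Ω, |v z|) ^ 2 ≤ (volume.real D.Ω + 1) * ip D.Ω v v := by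
  set S := ∫ z in D.Ω, |v z| with hS
  set V := volume.real D.Ω + 1 with hV
  have hVp : 0 < V := by positivity
  have i1 : Integrable (fun z => |v z|) (volume.restrict D.Ω) := (hv.integrable (by norm_num)).abs
  have i2 := hv.integrable_mul hv
  have h : 0 ≤ ∫ z in D.Ω, (|v z| - S / V) ^ 2 := integral_nonneg fun z => sq_nonneg _
  have e : ∀ z, (|v z| - S / V) ^ 2 = v z * v z - (2 * (S / V)) * |v z| + (S / V) ^ 2 := by
    intro z; rw [sub_sq, sq_abs]; ring
  simp only [e] at h
  have i3 := i1.const_mul (2 * (S / V))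
  rw [integral_add (f := fun z => v z * v z - 2 * (S / V) * |v z|) (i2.sub i3)
    (integrable_const _), integral_sub i2 i3, integral_const_mul, integral_const, ← hS, smul_eq_mul,
    measureReal_restrict_apply_univ] at h
  have e2 : S / V * V = S := div_mul_cancel₀ _ hVp.ne'
  have e3 : volume.real D.Ω = V - 1 := by simp [hV]
  rw [e3] at h
  change 0 ≤ ip D.Ω v v - _ + _ at h
  have h5 : S / V * S ≤ ip D.Ω v v := by
    have e4 : V * (S / V) ^ 2 = S / V * S := by
      rw [sq, ← mul_assoc, mul_comm V, e2, mul_comm]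
    nlinarith [sq_nonneg (S / V)]
  calc S ^ 2 = V * (S / V * S) := by rw [← mul_assoc, mul_comm V, e2]; ring
    _ ≤ _ := by gcongr

theorem integral_sq_fhat {φ : Pt → ℝ} (hφ : IsTest D.Ω φ) :
    ∫ k, ‖D.fhat φ k‖ ^ 2 = ip D.Ω φ φ := by
  rw [fhat_eq_schwartz hφ, SchwartzMap.integral_norm_sq_fourier, ip,
    ← integral_indicator D.measurableSet_Ω]
  congr 1; funext z
  have hz := congrFun (indicator_of_isTest hφ) z
  by_cases h : z ∈ D.Ω
  · simp only [indicator_of_mem h, IsTest.toSchwartz_apply, Complex.norm_real, Real.norm_eq_abs,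
      sq_abs]
    ring
  · simp only [indicator_of_notMem h] at hz ⊢
    simp [IsTest.toSchwartz_apply, ← hz]

/-- The fractional Poincaré inequality for test functions. -/
theorem exists_poincare (hM : D.IsSymbol M) :
    ∃ C : ℝ, 0 < C ∧ ∀ φ, IsTest D.Ω φ → ip D.Ω φ φ ≤ C * ∫ k, ‖D.energyDensity M φ k‖ ^ 2 := by
  obtain ⟨c, hc, hlow⟩ := hM.lower
  set V := volume.real D.Ω + 1 with hV
  have hVp : 0 < V := by positivity
  have hpi := Real.pi_pos
  have hα : 0 < D.α := by linarith [D.one_lt_α]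
  -- The radius makes `V π ε² = 1/2`. Frequencies below `ε`, where `|φ̂|² ≤ V A`, contribute at most
  -- `A/2`, which is absorbed on the left; above `ε` the symbol is at least `c ε^α = 1/K`. Hence the
  -- final constant `2K`.
  set ε : ℝ := Real.sqrt (1 / (2 * V * Real.pi)) with hε
  have hεp : 0 < ε := Real.sqrt_pos.mpr (by positivity)
  have hvol : volume.real (Metric.ball (0 : Pt) ε) * V = 1 / 2 := by
    rw [measureReal_def, EuclideanSpace.volume_ball_fin_two]
    simp only [ENNReal.toReal_mul, ENNReal.toReal_pow, ENNReal.toReal_ofReal hεp.le]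
    rw [hε, Real.sq_sqrt (by positivity)]
    rw [ENNReal.toReal_ofReal hpi.le]
    field_simp
  set K : ℝ := (c * ε ^ D.α)⁻¹ with hK
  have hKp : 0 < K := by positivity
  refine ⟨2 * K, by positivity, fun φ hφ => ?_⟩
  have hL := memL2_of_isTest hφ
  have hE := memLp_energyDensity_of_isTest hM hφ
  set A := ip D.Ω φ φ with hA
  have hA0 : 0 ≤ A := integral_nonneg fun z => mul_self_nonneg _
  have hpt : ∀ k, ‖D.fhat φ k‖ ^ 2 ≤ (Metric.ball (0 : Pt) ε).indicator (fun _ => V * A) k +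
      K * ‖D.energyDensity M φ k‖ ^ 2 := by
    intro k
    by_cases h : k ∈ Metric.ball (0 : Pt) ε
    · rw [indicator_of_mem h]
      have h1 : ‖D.fhat φ k‖ ^ 2 ≤ (∫ z in D.Ω, |φ z|) ^ 2 :=
        pow_le_pow_left₀ (norm_nonneg _) (norm_fhat_le φ k) 2
      have h2 := sq_integral_abs_le hL
      have : 0 ≤ K * ‖D.energyDensity M φ k‖ ^ 2 := by positivity
      linarith
    · rw [indicator_of_notMem h, zero_add, norm_energyDensity, mul_pow, Real.sq_sqrt (hM.nonneg k),
        ← mul_assoc]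
      have hk : ε ≤ ‖k‖ := by simpa using h
      have h1 : c * ε ^ D.α ≤ M k := le_trans (by gcongr) (hlow k)
      have : 1 ≤ K * M k := by
        rw [hK, ← div_eq_inv_mul, one_le_div (by positivity)]; exact h1
      nlinarith [sq_nonneg ‖D.fhat φ k‖]
  have iE : Integrable fun k => ‖D.energyDensity M φ k‖ ^ 2 :=
    (memLp_two_iff_integrable_sq_norm hE.1).mp hE
  have iB : Integrable ((Metric.ball (0 : Pt) ε).indicator (fun _ => V * A)) := by
    rw [integrable_indicator_iff measurableSet_ball]
    exact integrableOn_const measure_ball_lt_top.ne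
  have h := integral_mono_of_nonneg (ae_of_all _ fun k => sq_nonneg _)
    (iB.add (iE.const_mul K)) (ae_of_all _ hpt)
  rw [integral_sq_fhat hφ] at h
  change A ≤ ∫ k, (_ + _) at h
  rw [integral_add iB (iE.const_mul K), integral_const_mul, integral_indicator measurableSet_ball,
    setIntegral_const, smul_eq_mul, ← mul_assoc, hvol] at h
  linarith

theorem fhat_add {v w : Pt → ℝ} (hv : MemL2 D.Ω v) (hw : MemL2 D.Ω w) :
    D.fhat (fun z => v z + w z) = fun k => D.fhat v k + D.fhat w k := by
  funext k
  simp only [fhat, Real.fourier_eq]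
  rw [← integral_add]
  · congr 1; funext z
    by_cases h : z ∈ D.Ω <;> simp [h, smul_add]
  · exact (Real.fourierIntegral_convergent_iff k).2 (integrable_ext hv)
  · exact (Real.fourierIntegral_convergent_iff k).2 (integrable_ext hw)

theorem fhat_const_mul (r : ℝ) (v : Pt → ℝ) :
    D.fhat (fun z => r * v z) = fun k => r * D.fhat v k := by
  funext k
  simp only [fhat, Real.fourier_eq]
  rw [← integral_const_mul]
  congr 1; funext z
  by_cases h : z ∈ D.Ω
  · simp only [indicator_of_mem h, Circle.smul_def, smul_eq_mul]; push_cast; ring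
  · simp [h]

variable (D M) in
/-- Test functions together with their energy densities, in `L²(Ω) × L²(ℝ²)`. -/
def testGraph : Submodule ℝ
    (WithLp 2 (Lp ℝ 2 (volume.restrict D.Ω) × Lp ℂ 2 (volume : Measure Pt))) where
  carrier := {X | ∃ φ, IsTest D.Ω φ ∧ X.fst =ᵐ[volume.restrict D.Ω] φ ∧
    X.snd =ᵐ[volume] D.energyDensity M φ}
  add_mem' := by
    rintro X Y ⟨φ, hφ, h1, h2⟩ ⟨ψ, hψ, h3, h4⟩
    refine ⟨_, hφ.add hψ, ?_, ?_⟩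
    · filter_upwards [Lp.coeFn_add X.fst Y.fst, h1, h3] with z e e1 e2
      rw [WithLp.add_fst, e, Pi.add_apply, e1, e2]
    · filter_upwards [Lp.coeFn_add X.snd Y.snd, h2, h4] with k e e1 e2
      rw [WithLp.add_snd, e, Pi.add_apply, e1, e2, energyDensity, energyDensity, energyDensity,
        fhat_add (memL2_of_isTest hφ) (memL2_of_isTest hψ), mul_add]
  zero_mem' := by
    refine ⟨_, isTest_zero _, ?_, ?_⟩
    · rw [WithLp.zero_fst]; exact Lp.coeFn_zero _ _ _
    · rw [WithLp.zero_snd]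
      filter_upwards [Lp.coeFn_zero ℂ 2 (volume : Measure Pt)] with k hk
      have := congrFun (fhat_const_mul (D := D) 0 fun _ => 0) k
      simp only [zero_mul, Complex.ofReal_zero] at this
      rw [hk, energyDensity, this]; simp
  smul_mem' := by
    rintro r X ⟨φ, hφ, h1, h2⟩
    refine ⟨_, hφ.const_mul r, ?_, ?_⟩
    · filter_upwards [Lp.coeFn_smul r X.fst, h1] with z e e1
      rw [WithLp.smul_fst, e, Pi.smul_apply, e1, smul_eq_mul]
    · filter_upwards [Lp.coeFn_smul r X.snd, h2] with k e e1
      rw [WithLp.smul_snd, e, Pi.smul_apply, e1, energyDensity, energyDensity, fhat_const_mul]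
      simp only [Complex.real_smul]; ring

/-- Elements of the closure of the graph are functions in `H_0^{α/2}(Ω)` with their densities. -/
theorem mem_closure_testGraph (hM : D.IsSymbol M)
    {X : WithLp 2 (Lp ℝ 2 (volume.restrict D.Ω) × Lp ℂ 2 (volume : Measure Pt))}
    (hX : X ∈ (testGraph D M).topologicalClosure) :
    MemH0 D.Ω (D.α / 2) X.fst ∧ X.snd =ᵐ[volume] D.energyDensity M X.fst := by
  obtain ⟨x, hx, hlim⟩ := mem_closure_iff_seq_limit.mp hX
  choose φ hφ h1 h2 using hx
  have hL : MemL2 D.Ω X.fst := Lp.memLp X.fst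
  have hφL := fun n => memL2_of_isTest (hφ n)
  have l1 : Tendsto (fun n => (x n).fst) atTop (𝓝 X.fst) :=
    ((WithLp.prod_continuous_ofLp 2 _ _).fst.tendsto X).comp hlim
  have l2 : Tendsto (fun n => (x n).snd) atTop (𝓝 X.snd) :=
    ((WithLp.prod_continuous_ofLp 2 _ _).snd.tendsto X).comp hlim
  rw [Lp.tendsto_Lp_iff_tendsto_eLpNorm'] at l1 l2
  have t1 : Tendsto (fun n => eLpNorm (fun z => X.fst z - φ n z) 2 (volume.restrict D.Ω))
      atTop (𝓝 0) := by
    refine l1.congr fun n => ?_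
    rw [← eLpNorm_neg]
    refine eLpNorm_congr_ae ?_
    filter_upwards [h1 n] with z hz
    simp [hz]
  have t2 : Tendsto (fun n => eLpNorm (D.energyDensity M (φ n) - (X.snd : Pt → ℂ)) 2 volume)
      atTop (𝓝 0) := by
    refine l2.congr fun n => eLpNorm_congr_ae ?_
    filter_upwards [h2 n] with z hz
    simp [hz]
  -- Convergence in `L²(Ω)` implies convergence in `L¹(Ω)`, hence of the transforms at every
  -- frequency.
  have hpt : ∀ k, Tendsto (fun n => D.energyDensity M (φ n) k) atTop
      (𝓝 (D.energyDensity M X.fst k)) := by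
    intro k
    have hn : Tendsto (fun n => normL2 D.Ω fun z => X.fst z - φ n z) atTop (𝓝 0) := by
      simpa [normL2, Function.comp_def] using (ENNReal.tendsto_toReal ENNReal.zero_ne_top).comp t1
    have hb : Tendsto (fun n => Real.sqrt ((volume.real D.Ω + 1) *
        (normL2 D.Ω fun z => X.fst z - φ n z) ^ 2)) atTop (𝓝 0) := by
      have := (((hn.pow 2).const_mul (volume.real D.Ω + 1)).sqrt)
      simpa using this
    have : Tendsto (fun n => D.fhat (φ n) k) atTop (𝓝 (D.fhat X.fst k)) := by
      rw [tendsto_iff_norm_sub_tendsto_zero]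
      refine squeeze_zero (fun n => norm_nonneg _) (fun n => ?_) hb
      have hd := hL.sub (hφL n)
      have hd' : MemL2 D.Ω fun z => X.fst z - φ n z := hd
      rw [norm_sub_rev, ← congrFun (fhat_sub hL (hφL n)) k, normL2_sq hd']
      exact (norm_fhat_le _ k).trans (Real.le_sqrt_of_sq_le (sq_integral_abs_le hd'))
    exact this.const_mul _
  -- A subsequence of the densities converges almost everywhere to `X.snd`; comparison with the
  -- pointwise limit identifies it.
  have hae : X.snd =ᵐ[volume] D.energyDensity M X.fst := by
    have hm := tendstoInMeasure_of_tendsto_eLpNorm (by norm_num)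
      (fun n => (memLp_energyDensity_of_isTest hM (hφ n)).1) (Lp.memLp X.snd).1 t2
    obtain ⟨ns, hns, hlim'⟩ := hm.exists_seq_tendsto_ae
    filter_upwards [hlim'] with k hk
    exact tendsto_nhds_unique hk ((hpt k).comp hns.tendsto_atTop)
  refine ⟨(memH0_iff hM).mpr ⟨hL, φ, hφ, t1, ?_⟩, hae⟩
  refine t2.congr fun n => ?_
  rw [energyDensity_sub hL (hφL n), ← eLpNorm_neg]
  refine eLpNorm_congr_ae ?_
  filter_upwards [hae] with k hk
  simp [hk]

/-- Coercivity for Lax–Milgram: the Poincaré inequality holds on the graph, and both sides are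
continuous, so it passes to the closure. -/
theorem norm_sq_le_of_mem_closure_testGraph (hM : D.IsSymbol M) : ∃ C : ℝ, 0 < C ∧
    ∀ X ∈ (testGraph D M).topologicalClosure, ‖X‖ ^ 2 ≤ C * ‖X.snd‖ ^ 2 := by
  obtain ⟨C, hC, h⟩ := exists_poincare hM
  refine ⟨C + 1, by positivity, fun X hX => ?_⟩
  have hclosed : IsClosed {X : WithLp 2 (Lp ℝ 2 (volume.restrict D.Ω) ×
      Lp ℂ 2 (volume : Measure Pt)) | ‖X‖ ^ 2 ≤ (C + 1) * ‖X.snd‖ ^ 2} :=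
    isClosed_le (by fun_prop)
      (((WithLp.prod_continuous_ofLp 2 _ _).snd.norm.pow 2).const_mul _)
  refine closure_minimal ?_ hclosed hX
  rintro Y ⟨φ, hφ, h1, h2⟩
  have e1 : ‖Y.fst‖ ^ 2 = ip D.Ω φ φ := by
    rw [← real_inner_self_eq_norm_sq, L2.inner_def, ip]
    refine integral_congr_ae ?_
    filter_upwards [h1] with z hz
    rw [hz]; simp [sq]
  have e2 : ‖Y.snd‖ ^ 2 = ∫ k, ‖D.energyDensity M φ k‖ ^ 2 := by
    rw [← real_inner_self_eq_norm_sq (F := Lp ℂ 2 (volume : Measure Pt)), L2.inner_def]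
    refine integral_congr_ae ?_
    filter_upwards [h2] with z hz
    rw [hz, real_inner_self_eq_norm_sq]
  have := h φ hφ
  rw [mem_ofPred_eq, WithLp.prod_norm_sq_eq_of_L2, add_mul, one_mul, e1, e2]
  gcongr

/-- Existence of weak solutions. -/
theorem exists_energy_eq (hM : D.IsSymbol M) {f : Pt → ℝ} (hf : MemL2 D.Ω f) :
    ∃ v, MemH0 D.Ω (D.α / 2) v ∧ ∀ φ, IsTest D.Ω φ → D.energy M v φ = ip D.Ω f φ := by
  obtain ⟨C, hC, hcoer⟩ := norm_sq_le_of_mem_closure_testGraph hM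
  obtain ⟨X, hXS, hX⟩ := exists_inner_snd_eq_inner_fst
    (testGraph D M).isClosed_topologicalClosure hC hcoer (hf.toLp f)
  obtain ⟨hv, hsnd⟩ := mem_closure_testGraph hM hXS
  refine ⟨_, hv, fun φ hφ => ?_⟩
  have hφL := memL2_of_isTest hφ
  have hφE := memLp_energyDensity_of_isTest hM hφ
  have h : inner ℝ X.snd (hφE.toLp _) = inner ℝ (hf.toLp f) (hφL.toLp φ) :=
    hX (WithLp.toLp 2 (hφL.toLp φ, hφE.toLp _)) ((testGraph D M).le_topologicalClosure
      ⟨φ, hφ, hφL.coeFn_toLp, hφE.coeFn_toLp⟩)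
  rw [L2.inner_def, L2.inner_def] at h
  rw [energy, ip]
  have g1 : ∫ k, inner ℝ (X.snd k) (hφE.toLp _ k) =
      ∫ k, inner ℝ (D.energyDensity M X.fst k) (D.energyDensity M φ k) := by
    refine integral_congr_ae ?_
    filter_upwards [hsnd, hφE.coeFn_toLp] with k a1 a2
    rw [a1, a2]
  rw [← g1, h]
  refine integral_congr_ae ?_
  filter_upwards [hf.coeFn_toLp, hφL.coeFn_toLp] with z a1 a2
  rw [a1, a2]; simp [mul_comm]

theorem exists_isSolution {σ : ℝ} (hσ : σ = 1 ∨ σ = -1) {f : Pt → ℝ} (hf : MemL2 D.Ω f) :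
    ∃ v, D.IsSolution σ f v := by
  obtain ⟨M, hM⟩ := D.exists_isSymbol
  -- The operator is `-E`, so the energy problem is solved with data `-σ f`; then `σ² = 1` restores
  -- `f`.
  have hf' : MemL2 D.Ω fun z => (-σ) * f z := MemLp.const_mul hf _
  obtain ⟨v, hv, h⟩ := exists_energy_eq hM hf'
  refine ⟨v, hv, fun φ hφ => ?_⟩
  rw [ip_const_mul_right, ip_riesz hM hv.1 hφ, h φ hφ, ip_const_mul_left]
  rcases hσ with rfl | rfl <;> ring

end Data

/-! ### Optimality conditions for the exact and the discrete control -/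

theorem ip_add_left' {Ω : Set Pt} {f g h : Pt → ℝ}
    (hf : Integrable (fun z => f z * h z) (volume.restrict Ω))
    (hg : Integrable (fun z => g z * h z) (volume.restrict Ω)) :
    ip Ω (fun z => f z + g z) h = ip Ω f h + ip Ω g h := by
  simp only [ip, add_mul]
  exact integral_add hf hg

theorem ip_add_left {Ω : Set Pt} {f g h : Pt → ℝ} (hf : MemL2 Ω f) (hg : MemL2 Ω g)
    (hh : MemL2 Ω h) : ip Ω (fun z => f z + g z) h = ip Ω f h + ip Ω g h :=
  ip_add_left' (hf.integrable_mul hh) (hg.integrable_mul hh)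

theorem ip_sub_left {Ω : Set Pt} {f g h : Pt → ℝ} (hf : MemL2 Ω f) (hg : MemL2 Ω g)
    (hh : MemL2 Ω h) : ip Ω (fun z => f z - g z) h = ip Ω f h - ip Ω g h := by
  simp only [ip, sub_mul]
  exact integral_sub (hf.integrable_mul hh) (hg.integrable_mul hh)

theorem ip_sub_right {Ω : Set Pt} {f g h : Pt → ℝ} (hf : MemL2 Ω f) (hg : MemL2 Ω g)
    (hh : MemL2 Ω h) : ip Ω h (fun z => f z - g z) = ip Ω h f - ip Ω h g := by
  rw [ip_symm, ip_sub_left hf hg hh, ip_symm Ω f, ip_symm Ω g]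

theorem ip_self_nonneg (Ω : Set Pt) (f : Pt → ℝ) : 0 ≤ ip Ω f f :=
  integral_nonneg fun _ => mul_self_nonneg _

theorem MemL2.const_mul {Ω : Set Pt} {f : Pt → ℝ} (hf : MemL2 Ω f) (r : ℝ) :
    MemL2 Ω (fun z => r * f z) := MemLp.const_mul hf r

theorem MemL2.add {Ω : Set Pt} {f g : Pt → ℝ} (hf : MemL2 Ω f) (hg : MemL2 Ω g) :
    MemL2 Ω (fun z => f z + g z) := MemLp.add hf hg

theorem MemL2.sub {Ω : Set Pt} {f g : Pt → ℝ} (hf : MemL2 Ω f) (hg : MemL2 Ω g) :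
    MemL2 Ω (fun z => f z - g z) := MemLp.sub hf hg

theorem ip_le_normL2_mul_normL2 {Ω : Set Pt} {f g : Pt → ℝ} (hf : MemL2 Ω f) (hg : MemL2 Ω g) :
    ip Ω f g ≤ normL2 Ω f * normL2 Ω g := by
  have h : ip Ω f g = inner ℝ (hf.toLp f) (hg.toLp g) := by
    rw [L2.inner_def, ip]
    refine integral_congr_ae ?_
    filter_upwards [hf.coeFn_toLp, hg.coeFn_toLp] with z h1 h2
    rw [h1, h2]; simp [mul_comm]
  rw [h, normL2, normL2, ← Lp.norm_toLp f hf, ← Lp.norm_toLp g hg]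
  exact real_inner_le_norm _ _

theorem ip_add_const_mul_self {Ω : Set Pt} {f g : Pt → ℝ} (hf : MemL2 Ω f) (hg : MemL2 Ω g)
    (t : ℝ) : ip Ω (fun z => f z + t * g z) (fun z => f z + t * g z) =
      ip Ω f f + 2 * t * ip Ω f g + t ^ 2 * ip Ω g g := by
  have ht := hg.const_mul t
  rw [ip_add_left hf ht (hf.add ht), ip_symm _ f (fun z => f z + t * g z),
    ip_add_left hf ht hf, ip_const_mul_left, ip_const_mul_left,
    ip_symm _ g (fun z => f z + t * g z), ip_add_left hf ht hg, ip_const_mul_left, ip_symm _ g f]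
  ring

theorem nonneg_of_forall_nonneg_mul_add_sq {L K : ℝ}
    (h : ∀ t : ℝ, 0 < t → t ≤ 1 → 0 ≤ t * L + t ^ 2 * K) : 0 ≤ L := by
  by_contra hL
  push Not at hL
  have hK := abs_nonneg K
  have hd : 0 < |K| + 1 - L := by linarith
  -- If `L < 0`, this `t` lies in `(0, 1]` and gives `L + t |K| = t (L - 1) < 0`: an explicit form
  -- of dividing by `t` and letting `t → 0`.
  set t := -L / (|K| + 1 - L) with ht
  have htp : 0 < t := div_pos (by linarith) hd
  have ht1 : t ≤ 1 := by rw [ht, div_le_one hd]; linarith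
  have htd : t * (|K| + 1 - L) = -L := div_mul_cancel₀ _ hd.ne'
  have h1 := h t htp ht1
  have h2 : 0 ≤ L + t * K := by
    by_contra h3
    push Not at h3
    nlinarith
  nlinarith [mul_le_mul_of_nonneg_left (le_abs_self K) htp.le]

/-- With `x = -p/γ`, the value `r` is the projection of `x` onto `[v₁, v₂]`, so `(r - x)(q - r) ≥ 0`
for each `q` in the interval. This is the discrete optimality condition in pointwise form. -/
theorem nonneg_mul_sub_of_eq_proj {γ v₁ v₂ p q r : ℝ} (hγ : 0 < γ) (h1 : v₁ ≤ q) (h2 : q ≤ v₂)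
    (hr : r = max v₁ (min (-(1 / γ) * p) v₂)) : 0 ≤ (γ * r + p) * (q - r) := by
  have hp : p = -γ * (-(1 / γ) * p) := by field_simp
  set x := -(1 / γ) * p with hx
  have e : (γ * r + p) * (q - r) = γ * ((r - x) * (q - r)) := by rw [hp]; ring
  rw [e]
  refine mul_nonneg hγ.le ?_
  rcases le_total x v₂ with h | h
  · rw [min_eq_left h] at hr
    rcases le_total v₁ x with h' | h'
    · rw [max_eq_right h'] at hr; simp [hr]
    · rw [max_eq_left h'] at hr
      exact mul_nonneg (by linarith) (by linarith)
  · rw [min_eq_right h, max_eq_right (h1.trans h2)] at hr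
    exact mul_nonneg_of_nonpos_of_nonpos (by linarith) (by linarith)

namespace Data

variable {D : Data}

theorem memH0_add_const_mul {v w : Pt → ℝ} (hv : MemH0 D.Ω (D.α / 2) v)
    (hw : MemH0 D.Ω (D.α / 2) w) (t : ℝ) : MemH0 D.Ω (D.α / 2) (fun z => v z + t * w z) := by
  obtain ⟨M, hM⟩ := D.exists_isSymbol
  obtain ⟨hvL, φ, hφ, hA, hB⟩ := (memH0_iff hM).mp hv
  obtain ⟨hwL, ψ, hψ, hA', hB'⟩ := (memH0_iff hM).mp hw
  have lim : ∀ {x y : ℕ → ENNReal}, Tendsto x atTop (𝓝 0) → Tendsto y atTop (𝓝 0) →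
      Tendsto (fun n => x n + ‖t‖ₑ * y n) atTop (𝓝 0) := by
    intro x y hx hy
    have := hx.add (ENNReal.Tendsto.const_mul (a := ‖t‖ₑ) hy (Or.inr enorm_ne_top))
    simpa using this
  have e : ∀ n, (fun z => v z + t * w z - (φ n z + t * ψ n z)) =
      fun z => (v z - φ n z) + t * (w z - ψ n z) := fun n => by funext z; ring
  have dv := fun n => hvL.sub (memL2_of_isTest (hφ n))
  have dw := fun n => hwL.sub (memL2_of_isTest (hψ n))
  refine (memH0_iff hM).mpr ⟨hvL.add (hwL.const_mul t), fun n z => φ n z + t * ψ n z,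
    fun n => (hφ n).add ((hψ n).const_mul t), ?_, ?_⟩
  · refine tendsto_of_tendsto_of_tendsto_of_le_of_le tendsto_const_nhds (lim hA hA')
      (fun n => zero_le) fun n => ?_
    simp only [e]
    refine (eLpNorm_add_le (dv n).1 ((dw n).const_mul t).1 (by norm_num)).trans ?_
    gcongr
    exact (eLpNorm_const_smul t (fun z => w z - ψ n z) 2 _).le
  · refine tendsto_of_tendsto_of_tendsto_of_le_of_le tendsto_const_nhds (lim hB hB')
      (fun n => zero_le) fun n => ?_
    simp only [e]
    have e2 : D.energyDensity M (fun z => (v z - φ n z) + t * (w z - ψ n z)) =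
        D.energyDensity M (fun z => v z - φ n z) +
          t • D.energyDensity M (fun z => w z - ψ n z) := by
      funext k
      rw [Pi.add_apply, Pi.smul_apply, energyDensity, energyDensity, energyDensity,
        fhat_add (dv n) ((dw n).const_mul t), fhat_const_mul, Complex.real_smul]
      ring
    rw [e2]
    refine (eLpNorm_add_le (continuous_energyDensity hM (dv n)).aestronglyMeasurable
      ((continuous_energyDensity hM (dw n)).const_smul t).aestronglyMeasurable
      (by norm_num)).trans ?_
    gcongr
    exact (eLpNorm_const_smul t _ 2 _).le

/-- Needed for the source `g`, which is only in `L¹(Ω)`: its pairings make sense against bounded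
functions. -/
theorem integrable_mul_of_continuous_compact {f χ : Pt → ℝ} (hf : IntegrableOn f D.Ω)
    (hχ : Continuous χ) (hc : HasCompactSupport χ) :
    Integrable (fun z => f z * χ z) (volume.restrict D.Ω) := by
  obtain ⟨B, hB⟩ := hχ.bounded_above_of_compact_support hc
  exact Integrable.mul_bdd hf hχ.aestronglyMeasurable (ae_of_all _ hB)

theorem IsSolution.add_const_mul {σ : ℝ} {f r v w : Pt → ℝ} (hv : D.IsSolution σ f v)
    (hw : D.IsSolution σ r w) (hf : IntegrableOn f D.Ω) (hr : IntegrableOn r D.Ω) (t : ℝ) :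
    D.IsSolution σ (fun z => f z + t * r z) (fun z => v z + t * w z) := by
  refine ⟨memH0_add_const_mul hv.1 hw.1 t, fun φ hφ => ?_⟩
  obtain ⟨M, hM⟩ := D.exists_isSymbol
  rw [ip_add_left hv.1.1 (hw.1.1.const_mul t) ((memL2_riesz hM hφ).const_mul σ),
    ip_const_mul_left, hv.2 φ hφ, hw.2 φ hφ,
    ip_add_left' (integrable_mul_of_continuous_compact hf hφ.1.continuous hφ.2.1)
      (integrable_mul_of_continuous_compact (hr.const_mul t) hφ.1.continuous hφ.2.1),
    ip_const_mul_left]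

/-- The first-order optimality condition. -/
theorem IsOptimal.variational_inequality {σ : ℝ} (hσ : σ = 1 ∨ σ = -1)
    (hg : IntegrableOn D.g D.Ω) (hud : MemL2 D.Ω D.ud) {q p u q' : Pt → ℝ}
    (hopt : D.IsOptimal σ q u) (hp : D.IsCostate σ u p) (hq' : D.Admissible q') :
    0 ≤ ip D.Ω (fun z => D.γ * q z + p z) (fun z => q' z - q z) := by
  obtain ⟨hq, hu, hmin⟩ := hopt
  have hr := hq'.1.sub hq.1
  -- `w` is the derivative of the state in the direction `q' - q`. By linearity `u + t w` is the
  -- state of `q + t (q' - q)`, so no existence result with `g` on the right is required.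
  obtain ⟨w, hw⟩ := exists_isSolution hσ hr
  have hy := hu.1.1.sub hud
  have hI : ∀ {f : Pt → ℝ}, MemL2 D.Ω f → IntegrableOn f D.Ω := fun hf =>
    MemLp.integrable (by norm_num) hf
  -- The adjoint identity: the derivative `(u - u_d, w)` of the tracking term equals `(q' - q, p)`.
  have hcomm := IsSolution.ip_comm hp hw hy hr
  have key : 0 ≤ ip D.Ω (fun z => u z - D.ud z) w + D.γ * ip D.Ω q (fun z => q' z - q z) := by
    refine nonneg_of_forall_nonneg_mul_add_sq (K := 1 / 2 * ip D.Ω w w +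
      D.γ / 2 * ip D.Ω (fun z => q' z - q z) (fun z => q' z - q z)) fun t ht0 ht1 => ?_
    have hadm : D.Admissible (fun z => q z + t * (q' z - q z)) := by
      refine ⟨hq.1.add (hr.const_mul t), ?_⟩
      filter_upwards [hq.2, hq'.2] with z h1 h2
      constructor <;> nlinarith [h1.1, h1.2, h2.1, h2.2]
    have hsol := hu.add_const_mul hw (hg.add (hI hq.1)) (hI hr) t
    have hsol' : D.IsSolution σ (fun z => D.g z + (q z + t * (q' z - q z)))
        (fun z => u z + t * w z) := by simpa only [add_assoc] using hsol
    have hJ := hmin _ _ hadm hsol'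
    have e : (fun z => u z + t * w z - D.ud z) = fun z => (u z - D.ud z) + t * w z := by
      funext z; ring
    rw [J, J, e, normL2_sq hy, normL2_sq hq.1, normL2_sq (hy.add (hw.1.1.const_mul t)),
      normL2_sq hadm.1, ip_add_const_mul_self hy hw.1.1, ip_add_const_mul_self hq.1 hr] at hJ
    linarith
  rw [ip_add_left (hq.1.const_mul _) hp.1.1 hr, ip_const_mul_left, ip_symm _ p, ← hcomm]
  linarith

/-! ### The Galerkin scheme -/

theorem Λ_comm (v w : Pt → ℝ) : D.Λ v w = D.Λ w v := by
  rw [Λ, Λ, ip_symm _ (leftX _ _ w), ip_symm _ (rightX _ _ w), ip_symm _ (leftY _ _ w),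
    ip_symm _ (rightY _ _ w)]
  ring

theorem Mesh.MemV.hasCompactSupport {T : D.Mesh} {v : Pt → ℝ} (hv : T.MemV v) :
    HasCompactSupport v :=
  HasCompactSupport.of_support_subset_isCompact D.isBounded_Ω.isCompact_closure fun z hz =>
    subset_closure (by_contra fun h => hz (hv.2.1 z h))

theorem Mesh.MemV.memL2 {T : D.Mesh} {v : Pt → ℝ} (hv : T.MemV v) : MemL2 D.Ω v :=
  (hv.1.memLp_of_hasCompactSupport hv.hasCompactSupport).restrict _

theorem Mesh.h_nonneg (T : D.Mesh) : 0 ≤ T.h := Real.iSup_nonneg fun _ => Metric.diam_nonneg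

/-- This makes `q_h` a legitimate competitor in the exact variational inequality. The order `v₁ ≤
v₂`, needed for the upper bound, is read off from the admissible `q`. -/
theorem Mesh.IsDiscreteSolution.admissible {T : D.Mesh} {q qh ph uh : Pt → ℝ}
    (h : T.IsDiscreteSolution qh ph uh) (hq : D.Admissible q) : D.Admissible qh := by
  constructor
  · have hF : MemL2 D.Ω fun z => max D.v₁ (min (-(1 / D.γ) * ph z) D.v₂) := by
      have hc := h.2.1.1.1
      refine MemLp.of_bound (Continuous.aestronglyMeasurable (by fun_prop)) (|D.v₁| + |D.v₂|)
        (ae_of_all _ fun z => ?_)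
      rw [Real.norm_eq_abs, abs_le]
      have h1 := le_max_left D.v₁ (min (-(1 / D.γ) * ph z) D.v₂)
      constructor
      · linarith [neg_abs_le D.v₁, abs_nonneg D.v₂]
      · exact max_le (by linarith [le_abs_self D.v₁, abs_nonneg D.v₂])
          ((min_le_right _ _).trans (by linarith [le_abs_self D.v₂, abs_nonneg D.v₁]))
    exact MemLp.ae_eq (EventuallyEq.symm h.2.2) hF
  · filter_upwards [h.2.2, hq.2] with z h1 h2
    rw [h1]
    exact ⟨le_max_left _ _, max_le (h2.1.trans h2.2) (min_le_right _ _)⟩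

/-- The control-to-costate map of the Galerkin scheme is monotone. -/
theorem Mesh.ip_costate_sub_control_nonpos {T : D.Mesh} (hg : IntegrableOn D.g D.Ω)
    (hud : MemL2 D.Ω D.ud) {q qh ph uh uhq phq : Pt → ℝ} (hq : MemL2 D.Ω q) (hqh : MemL2 D.Ω qh)
    (huh : T.IsGalerkin (fun z => D.g z + qh z) uh)
    (hph : T.IsGalerkin (fun z => uh z - D.ud z) ph)
    (huhq : T.IsGalerkin (fun z => D.g z + q z) uhq)
    (hphq : T.IsGalerkin (fun z => uhq z - D.ud z) phq) :
    ip D.Ω (fun z => phq z - ph z) (fun z => qh z - q z) ≤ 0 := by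
  have state : ∀ {r y χ : Pt → ℝ}, MemL2 D.Ω r → T.IsGalerkin (fun z => D.g z + r z) y →
      T.MemV χ → D.Λ y χ = ip D.Ω D.g χ + ip D.Ω r χ := by
    intro r y χ hr hy hχ
    rw [hy.2 χ hχ, ip_add_left' (integrable_mul_of_continuous_compact hg hχ.1
      hχ.hasCompactSupport) (hr.integrable_mul hχ.memL2)]
  have costate : ∀ {y w χ : Pt → ℝ}, T.MemV y → T.IsGalerkin (fun z => y z - D.ud z) w →
      T.MemV χ → D.Λ χ w = ip D.Ω y χ - ip D.Ω D.ud χ := by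
    intro y w χ hy hw hχ
    rw [Λ_comm, hw.2 χ hχ, ip_sub_left hy.memL2 hud hχ.memL2]
  -- Each line evaluates `Λ` in two ways at one of the four pairs of state and costate, using only
  -- the symmetry of `Λ`. The combination `e1 - e2 - e3 + e4` replaces testing with differences, so
  -- additivity of `Λ`, and hence integrability of the fractional derivatives, is never needed. The
  -- terms with `g` and `u_d` cancel and `-‖u_h(q) - u_h‖²` remains.
  have e1 := (state hqh huh hphq.1).symm.trans (costate huhq.1 hphq huh.1)
  have e2 := (state hq huhq hphq.1).symm.trans (costate huhq.1 hphq huhq.1)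
  have e3 := (state hqh huh hph.1).symm.trans (costate huh.1 hph huh.1)
  have e4 := (state hq huhq hph.1).symm.trans (costate huh.1 hph huhq.1)
  have hpos := ip_self_nonneg D.Ω (fun z => uhq z - uh z)
  have lq := huhq.1.memL2
  have lh := huh.1.memL2
  rw [ip_sub_left lq lh (lq.sub lh), ip_sub_right lq lh lq, ip_sub_right lq lh lh] at hpos
  have lp := hphq.1.memL2
  have lph := hph.1.memL2
  rw [ip_sub_left lp lph (hqh.sub hq), ip_sub_right hqh hq lp, ip_sub_right hqh hq lph,
    ip_symm _ phq, ip_symm _ phq, ip_symm _ ph, ip_symm _ ph]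
  rw [ip_symm _ uh uhq] at *
  linarith

end Data

end RieszOCP

/-! ### The error estimate -/

theorem lemma4p1 (D : RieszOCP.Data)
    (hg : MeasureTheory.IntegrableOn D.g D.Ω) (hud : RieszOCP.MemL2 D.Ω D.ud)
    (σ : ℝ) (hσ : σ = 1 ∨ σ = -1)
    (q p u : RieszOCP.Pt → ℝ)
    (hopt : D.IsOptimal σ q u) (hp : D.IsCostate σ u p)
    (hq : RieszOCP.MemH1 D.Ω q) :
    ∃ C : ℝ, 0 < C ∧ ∀ (T : D.Mesh) (qh ph uh uhq phq : RieszOCP.Pt → ℝ),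
      T.IsDiscreteSolution qh ph uh →
      T.IsGalerkin (fun z => D.g z + q z) uhq →
      T.IsGalerkin (fun z => uhq z - D.ud z) phq →
      RieszOCP.normL2 D.Ω (fun z => q z - qh z) ≤
        C * T.h + C * RieszOCP.normL2 D.Ω (fun z => p z - phq z) := by
  have hγ := D.γ_pos
  refine ⟨1 / D.γ, by positivity, fun T qh ph uh uhq phq hd huhq hphq => ?_⟩
  have hadm := hd.admissible hopt.1
  have lq := hopt.1.1
  have lqh := hadm.1
  have lp := hp.1.1
  have lph := hd.2.1.1.memL2
  have lphq := hphq.1.memL2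
  have h1 := hopt.variational_inequality hσ hg hud hp hadm
  have h2 : 0 ≤ RieszOCP.ip D.Ω (fun z => D.γ * qh z + ph z) (fun z => q z - qh z) := by
    refine integral_nonneg_of_ae ?_
    filter_upwards [hd.2.2, hopt.1.2] with z hz hz'
    exact RieszOCP.nonneg_mul_sub_of_eq_proj hγ hz'.1 hz'.2 hz
  have h3 := RieszOCP.Data.Mesh.ip_costate_sub_control_nonpos hg hud lq lqh hd.1 hd.2.1 huhq hphq
  have h4 := RieszOCP.ip_le_normL2_mul_normL2 (lphq.sub lp) (lq.sub lqh)
  have e1 := RieszOCP.normL2_sq (lq.sub lqh)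
  have e2 : RieszOCP.normL2 D.Ω (fun z => phq z - p z) =
      RieszOCP.normL2 D.Ω (fun z => p z - phq z) := by
    rw [RieszOCP.normL2, RieszOCP.normL2, ← eLpNorm_neg]
    congr 2
    funext z
    simp
  rw [e2] at h4
  set e := RieszOCP.normL2 D.Ω (fun z => q z - qh z)
  set r := RieszOCP.normL2 D.Ω (fun z => p z - phq z)
  have he : 0 ≤ e := ENNReal.toReal_nonneg
  have hr : 0 ≤ r := ENNReal.toReal_nonneg
  -- The sum of `h1`, `h2`, `h3` and `h4`: the terms with `p_h` cancel, and the terms with `γ`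
  -- combine to `γ ‖q - q_h‖²`.
  have main : D.γ * e ^ 2 ≤ r * e := by
    have l1 := lq.const_mul D.γ
    have l2 := lqh.const_mul D.γ
    rw [RieszOCP.ip_add_left l1 lp (lqh.sub lq), RieszOCP.ip_const_mul_left,
      RieszOCP.ip_sub_right lqh lq lq, RieszOCP.ip_sub_right lqh lq lp] at h1
    rw [RieszOCP.ip_add_left l2 lph (lq.sub lqh), RieszOCP.ip_const_mul_left,
      RieszOCP.ip_sub_right lq lqh lqh, RieszOCP.ip_sub_right lq lqh lph] at h2
    rw [RieszOCP.ip_sub_left lphq lph (lqh.sub lq), RieszOCP.ip_sub_right lqh lq lphq,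
      RieszOCP.ip_sub_right lqh lq lph] at h3
    rw [RieszOCP.ip_sub_left lphq lp (lq.sub lqh), RieszOCP.ip_sub_right lq lqh lphq,
      RieszOCP.ip_sub_right lq lqh lp] at h4
    rw [RieszOCP.ip_sub_left lq lqh (lq.sub lqh), RieszOCP.ip_sub_right lq lqh lq,
      RieszOCP.ip_sub_right lq lqh lqh] at e1
    rw [e1]
    linarith
  have hh : 0 ≤ 1 / D.γ * T.h := mul_nonneg (by positivity) T.h_nonneg
  have : e ≤ 1 / D.γ * r := by
    rw [one_div_mul_eq_div, le_div_iff₀ hγ]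
    -- Cancelling one factor `e` requires `e > 0`; for `e = 0` the bound is trivial.
    rcases he.eq_or_lt with h0 | h0
    · rw [← h0, zero_mul]; exact hr
    · exact le_of_mul_le_mul_right (by linarith [sq e]) h0
  linarith
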